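/- Let $M$ be a smooth $n$-dimensional manifold (without boundary) and let $L:TM\to[0,\infty)$ be a Finsler norm: $L$ is smooth on $TM\setminus 0$, and for every $x\in M$ its restriction to $T_xM$ is a Minkowski norm, i.e. it is smooth on $T_xM\setminus\{0\}$, satisfies $L(cy)=cL(y)$ for $c>0$, and for every $y\in T_xM\setminus\{0\}$ the bilinear form $$g_y(u,v)=\frac12\,\frac{\partial^2}{\partial s\,\partial t}\Big|_{s=t=0}L^2(y+su+tv)$$ on $T_xM$ is positive definite. Let $\mathcal L:TM\to T^*M$ be the Legendre transformation, $\mathcal L(y)=g_y(y,\cdot)$ for $y\neq0$ and $\mathcal L(0)=0$ on each fibre. Let $\alpha$ be the Liouville $1$-form on $T^*M$, $\alpha_\xi=\xi\circ d\pi_\xi$ with $\pi:T^*M\to M$ the projection, and let $\omega=-d\alpha$ be the canonical symplectic form. Let $\eta$ be the Hilbert $1$-form on $TM\setminus 0$, given in the coordinates $(x^i,y^i)$ of $TM$ induced by a chart $(x^i)$ of $M$ by $\eta|_y=-g_{ij}(y)\,y^i\,dx^j|_y$, where $g_{ij}(y)=g_y(\partial/\partial x^i,\partial/\partial x^j)$.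 Then $\eta$ is a globally defined smooth $1$-form on $TM\setminus 0$ (its local expression does not depend on the chart), and 1. $\mathcal L^*\alpha=-\eta$ on $TM\setminus 0$; 2. $d\eta$ is a symplectic form on $TM\setminus 0$ (smooth, closed and nondegenerate); 3. $\mathcal L$ restricts to a symplectomorphism $(TM\setminus 0,\,d\eta)\to(T^*M\setminus 0,\,\omega)$, i.e. to a smooth diffeomorphism of $TM\setminus 0$ onto $T^*M\setminus 0$ with $\mathcal L^*\omega=d\eta$. -/

import Mathlib

open Set Bundle
open scoped Manifold ContDiff Topology

noncomputable section

namespace Finsler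

/-! ### Differential forms on manifolds without boundary -/

section Forms

variable {E : Type*} [NormedAddCommGroup E] [NormedSpace ℝ E]
  {H : Type*} [TopologicalSpace H]
  {E' : Type*} [NormedAddCommGroup E'] [NormedSpace ℝ E']
  {H' : Type*} [TopologicalSpace H']

/-- A (not necessarily continuous) differential `k`-form on the manifold `X`: an alternating
`k`-linear form on each tangent space. -/
abbrev Form (I : ModelWithCorners ℝ E H) (X : Type*) [TopologicalSpace X] [ChartedSpace H X]
    (k : ℕ) : Type _ :=
  (p : X) → (TangentSpace I p) [⋀^Fin k]→L[ℝ] ℝ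

variable {I : ModelWithCorners ℝ E H} {X : Type*} [TopologicalSpace X] [ChartedSpace H X]
  {J : ModelWithCorners ℝ E' H'} {Y : Type*} [TopologicalSpace Y] [ChartedSpace H' Y]
  {k : ℕ}

/-- The `1`-form given by a covector at each point. -/
def oneForm (a : (p : X) → (TangentSpace I p →L[ℝ] ℝ)) : Form I X 1 :=
  fun p => ContinuousAlternatingMap.ofSubsingleton ℝ (TangentSpace I p) ℝ (0 : Fin 1) (a p)

/-- The pullback `(f^* θ)_p (v₁, …, v_k) = θ_{f p} (df_p v₁, …, df_p v_k)`. -/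
def pullback (f : X → Y) (θ : Form J Y k) : Form I X k :=
  fun p => (θ (f p)).compContinuousLinearMap (mfderiv I J f p)

/-- The expression of the form `θ` in the preferred chart `φ` at `p`, that is, the form
`(φ⁻¹)^* θ` on the model vector space (meaningful on the target of `φ`). -/
def inChart (θ : Form I X k) (p : X) : E → E [⋀^Fin k]→L[ℝ] ℝ :=
  fun x => (θ ((extChartAt I p).symm x)).compContinuousLinearMap
    (mfderiv 𝓘(ℝ, E) I (extChartAt I p).symm x)

/-- The form `θ` is smooth on the open set `U`: its expressions in charts are smooth. -/
def IsSmoothOn (θ : Form I X k) (U : Set X) : Prop :=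
  ∀ p : X, ContDiffOn ℝ ∞ (inChart θ p)
    ((extChartAt I p).target ∩ (extChartAt I p).symm ⁻¹' U)

/-- The exterior derivative of a form. At `p` it is computed in the preferred chart `φ` at `p`:
`(dθ)_p = φ^* d((φ⁻¹)^* θ)`. -/
def extDer (θ : Form I X k) : Form I X (k + 1) :=
  fun p => (extDeriv (inChart θ p) (extChartAt I p p)).compContinuousLinearMap
    (mfderiv I 𝓘(ℝ, E) (extChartAt I p) p)

/-- `θ` is a symplectic form on the open set `U`: it is smooth, closed and nondegenerate at each
point of `U`. -/
structure IsSymplecticOn (θ : Form I X 2) (U : Set X) : Prop where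
  isOpen : IsOpen U
  smooth : IsSmoothOn θ U
  closed : ∀ p ∈ U, extDer θ p = 0
  nondegenerate : ∀ p ∈ U, ∀ v : TangentSpace I p,
    (∀ w : TangentSpace I p, θ p ![v, w] = 0) → v = 0

/-- `f` restricts to a smooth diffeomorphism of the open set `U` onto the open set `V`. -/
structure IsDiffeoOn (I : ModelWithCorners ℝ E H) (J : ModelWithCorners ℝ E' H')
    (f : X → Y) (U : Set X) (V : Set Y) : Prop where
  isOpen_source : IsOpen U
  isOpen_target : IsOpen V
  bijOn : BijOn f U V
  smooth : ContMDiffOn I J ∞ f U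
  smooth_inverse : ∃ g : Y → X, InvOn g f U V ∧ ContMDiffOn J I ∞ g V

/-- `f` restricts to a symplectomorphism of the symplectic manifold `(U, θ)` onto the symplectic
manifold `(V, θ')`, where `U` and `V` are open sets. -/
structure IsSymplectomorphismOn (f : X → Y) (θ : Form I X 2) (U : Set X)
    (θ' : Form J Y 2) (V : Set Y) : Prop where
  symplectic_source : IsSymplecticOn θ U
  symplectic_target : IsSymplecticOn θ' V
  diffeo : IsDiffeoOn I J f U V
  pullback_eq : ∀ p ∈ U, pullback f θ' p = θ p

end Forms

/-! ### Minkowski norms -/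

section Minkowski

variable {V : Type*} [NormedAddCommGroup V] [NormedSpace ℝ V]

/-- The fundamental tensor
`g_y(u, v) = (1/2) ∂²/∂s∂t N²(y + s u + t v)` at `s = t = 0`,
i.e. half of the second derivative of `N²` at `y`. -/
def fundamentalTensor (N : V → ℝ) (y : V) : V →L[ℝ] V →L[ℝ] ℝ :=
  (1 / 2 : ℝ) • fderiv ℝ (fun z => fderiv ℝ (fun w => N w ^ 2) z) y

/-- Minkowski norms on a (finite-dimensional) vector space. -/
structure IsMinkowskiNorm (N : V → ℝ) : Prop where
  nonneg : ∀ y, 0 ≤ N y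
  smooth : ContDiffOn ℝ ∞ N {y | y ≠ 0}
  homogeneous : ∀ (c : ℝ) (y : V), 0 < c → N (c • y) = c * N y
  posDef : ∀ y, y ≠ 0 → ∀ u, u ≠ 0 → 0 < fundamentalTensor N y u u

end Minkowski

/-! ### Tangent and cotangent bundles, Finsler norms, Legendre transformation -/

variable {n : ℕ} {M : Type*} [TopologicalSpace M] [ChartedSpace (EuclideanSpace ℝ (Fin n)) M]

variable (n M) in
/-- The cotangent bundle `T*M`. -/
abbrev CotangentBundle : Type _ :=
  TotalSpace (EuclideanSpace ℝ (Fin n) →L[ℝ] ℝ)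
    (fun x : M => TangentSpace (𝓡 n) x →L[ℝ] Trivial M ℝ x)

variable (n) in
/-- The model with corners of the tangent bundle of an `n`-manifold. -/
abbrev modelT := (𝓡 n).prod 𝓘(ℝ, EuclideanSpace ℝ (Fin n))

variable (n) in
/-- The model with corners of the cotangent bundle of an `n`-manifold. -/
abbrev modelCoT := (𝓡 n).prod 𝓘(ℝ, EuclideanSpace ℝ (Fin n) →L[ℝ] ℝ)

variable (n M) in
/-- `TM ∖ 0`. -/
def slitTangent : Set (TangentBundle (𝓡 n) M) := {p | p.snd ≠ 0}

variable (n M) in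
/-- `T*M ∖ 0`. -/
def slitCotangent : Set (CotangentBundle n M) := {p | p.snd ≠ 0}

/-- The restriction of a function on `TM` to the tangent space at `x`, the latter being, as a
vector space, the model space of `M`. -/
def fiberRestrict (L : TangentBundle (𝓡 n) M → ℝ) (x : M) : EuclideanSpace ℝ (Fin n) → ℝ :=
  fun v => L ⟨x, v⟩

/-- The fundamental tensor `g_y` of `L`, a bilinear form on the tangent space that contains `y`. -/
def metricTensor (L : TangentBundle (𝓡 n) M → ℝ) (y : TangentBundle (𝓡 n) M) :
    TangentSpace (𝓡 n) y.proj →L[ℝ] TangentSpace (𝓡 n) y.proj →L[ℝ] ℝ :=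
  fundamentalTensor (fiberRestrict L y.proj) y.snd

/-- The Legendre transformation `y ↦ g_y(y, ·)`; it sends zero vectors to zero covectors, see
`legendre_zero`. -/
def legendre (L : TangentBundle (𝓡 n) M → ℝ) (y : TangentBundle (𝓡 n) M) :
    CotangentBundle n M :=
  ⟨y.proj, metricTensor L y y.snd⟩

theorem legendre_zero (L : TangentBundle (𝓡 n) M → ℝ) (x : M) :
    legendre L ⟨x, 0⟩ = ⟨x, 0⟩ := by
  simp [legendre]

variable [IsManifold (𝓡 n) ∞ M]

/-- A Finsler norm on `M`: a function on `TM` that is smooth on `TM ∖ 0` and restricts to a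
Minkowski norm on each tangent space. -/
structure IsFinslerNorm (L : TangentBundle (𝓡 n) M → ℝ) : Prop where
  smooth : ContMDiffOn (modelT n) 𝓘(ℝ, ℝ) ∞ L (slitTangent n M)
  minkowski : ∀ x : M, IsMinkowskiNorm (fiberRestrict L x)

/-! ### The Liouville form and the Hilbert form -/

variable (n M) in
/-- The Liouville form `α_ξ = ξ ∘ dπ_ξ` on `T*M`, where `π : T*M → M` is the projection. -/
def liouvilleForm : Form (modelCoT n) (CotangentBundle n M) 1 :=
  oneForm fun ξ =>
    (ξ.snd : TangentSpace (𝓡 n) ξ.proj →L[ℝ] ℝ).comp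
      (mfderiv (modelCoT n) (𝓡 n) (fun ζ : CotangentBundle n M => ζ.proj) ξ)

variable (n M) in
/-- The canonical `2`-form `ω = -dα` on `T*M`. -/
def canonicalForm : Form (modelCoT n) (CotangentBundle n M) 2 :=
  -extDer (liouvilleForm n M)

/-- The coordinate vector field `∂/∂x^i` of the chart `e`, at `x`. -/
def coordVector (e : OpenPartialHomeomorph M (EuclideanSpace ℝ (Fin n))) (x : M) (i : Fin n) :
    TangentSpace (𝓡 n) x :=
  (mfderiv (𝓡 n) (𝓡 n) e x).inverse
    ((NormedSpace.fromTangentSpace (𝕜 := ℝ) (e x)).symm (EuclideanSpace.single i (1 : ℝ)))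

/-- The `i`-th component `y^i` of the tangent vector `y` in the chart `e`. -/
def fiberCoord (e : OpenPartialHomeomorph M (EuclideanSpace ℝ (Fin n)))
    (y : TangentBundle (𝓡 n) M) (i : Fin n) : ℝ :=
  (NormedSpace.fromTangentSpace (𝕜 := ℝ) (e y.proj) (mfderiv (𝓡 n) (𝓡 n) e y.proj y.snd)) i

/-- The coefficient `g_ij(y)` of the fundamental tensor in the chart `e`. -/
def metricCoeff (L : TangentBundle (𝓡 n) M → ℝ)
    (e : OpenPartialHomeomorph M (EuclideanSpace ℝ (Fin n)))
    (y : TangentBundle (𝓡 n) M) (i j : Fin n) : ℝ :=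
  metricTensor L y (coordVector e y.proj i) (coordVector e y.proj j)

/-- The differential at `y ∈ TM` of the `j`-th base coordinate `x^j` of the chart `e`, seen as a
function on the part of `TM` above the domain of `e`. -/
def baseCoordDiff (e : OpenPartialHomeomorph M (EuclideanSpace ℝ (Fin n)))
    (y : TangentBundle (𝓡 n) M) (j : Fin n) : TangentSpace (modelT n) y →L[ℝ] ℝ :=
  (NormedSpace.fromTangentSpace (𝕜 := ℝ) (e y.proj j)).toContinuousLinearMap.comp
    (mfderiv (modelT n) 𝓘(ℝ, ℝ) (fun z : TangentBundle (𝓡 n) M => e z.proj j) y)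

/-- The expression `-g_ij(y) y^i dx^j` of the Hilbert form in the chart `e`, meaningful on the part
of `TM ∖ 0` above the domain of `e`. -/
def hilbertFormIn (L : TangentBundle (𝓡 n) M → ℝ)
    (e : OpenPartialHomeomorph M (EuclideanSpace ℝ (Fin n))) :
    Form (modelT n) (TangentBundle (𝓡 n) M) 1 :=
  oneForm fun y =>
    -∑ i, ∑ j, (metricCoeff L e y i j * fiberCoord e y i) • baseCoordDiff e y j

/-- The Hilbert form `η` on `TM ∖ 0`, computed at `y` in the preferred chart of `M` at the base
point of `y`. -/
def hilbertForm (L : TangentBundle (𝓡 n) M → ℝ) :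
    Form (modelT n) (TangentBundle (𝓡 n) M) 1 :=
  fun y => hilbertFormIn L (chartAt (EuclideanSpace ℝ (Fin n)) y.proj) y

end Finsler

end

open Set Bundle
open scoped Manifold ContDiff Topology

noncomputable section

namespace Finsler

/-! ### Calculus of differential forms in charts -/

section FormCalculus

variable {E : Type*} [NormedAddCommGroup E] [NormedSpace ℝ E]
  {H : Type*} [TopologicalSpace H]
  {E' : Type*} [NormedAddCommGroup E'] [NormedSpace ℝ E']
  {H' : Type*} [TopologicalSpace H']
  {I : ModelWithCorners ℝ E H} {X : Type*} [TopologicalSpace X] [ChartedSpace H X]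
  {J : ModelWithCorners ℝ E' H'} {Y : Type*} [TopologicalSpace Y] [ChartedSpace H' Y]
  {k : ℕ}

/-! By Euler's relation for the 2-homogeneous function `L²`, the covector `g_y(y, ·)` is the
fibrewise differential of `L²/2`. The Legendre transformation is therefore smooth on the slit bundle
and covers the identity of `M`.

Because it commutes with the projections, it pulls the Liouville form back to `w ↦ g_y(y, dπ w)`.
Expanding both arguments in coordinate vectors shows that this is `-η` in every chart, so `η` is
chart independent (`hilbertFormIn_eq`, `pullback_legendre_liouvilleForm`). Naturality of the
exterior derivative (`extDer_pullback`) then turns `ω = -dα` into `𝓛^* ω = dη`.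

The transformation is a diffeomorphism of the slit bundles. On a fibre it is injective because the
differential of `N²` is strictly monotone along segments (`eq_of_fderiv_sq_eq`), and surjective
because `N² - 2ξ` attains its minimum away from `0` (`exists_fundamentalTensor_self_eq`). In bundle
charts its derivative is block triangular, with the identity on the base and `g_y` on the fibre
(`fderiv_fiberLegendre_injective`), so the inverse function theorem makes the inverse smooth.

In bundle charts `α` is the tautological form (`inChart_liouvilleForm`), so `ω` is nondegenerate,
and `dη` inherits this through the invertible derivative of `𝓛`. Closedness is `d² = 0`. -/

theorem Form.apply_congr (θ : Form J Y k) {q q' : Y} (h : q = q') (v : Fin k → E') :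
    (θ q : E' [⋀^Fin k]→L[ℝ] ℝ) v = (θ q' : E' [⋀^Fin k]→L[ℝ] ℝ) v := by
  subst h; rfl

theorem minSmoothness_two_le_infty : minSmoothness ℝ 2 ≤ (∞ : ℕ∞ω) := by
  rw [minSmoothness_of_isRCLikeNormedField]
  exact WithTop.coe_le_coe.2 le_top

theorem mdifferentiableAt_extChartAt_symm [I.Boundaryless] [IsManifold I ∞ X] {p : X} {x : E}
    (hx : x ∈ (extChartAt I p).target) :
    MDifferentiableAt 𝓘(ℝ, E) I (extChartAt I p).symm x :=
  ((contMDiffOn_extChartAt_symm (n := ∞) p).contMDiffAt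
    ((isOpen_extChartAt_target p).mem_nhds hx)).mdifferentiableAt (by simp)

theorem mdifferentiableAt_extChartAt' [IsManifold I ∞ X] {p q : X}
    (hq : q ∈ (extChartAt I p).source) : MDifferentiableAt I 𝓘(ℝ, E) (extChartAt I p) q :=
  (contMDiffAt_extChartAt' (n := ∞) (by simpa using hq)).mdifferentiableAt (by simp)

theorem mfderiv_extChartAt_comp_mfderiv_symm [I.Boundaryless] [IsManifold I ∞ X] {p : X} {x : E}
    (hx : x ∈ (extChartAt I p).target) (v : E) :
    mfderiv I 𝓘(ℝ, E) (extChartAt I p) ((extChartAt I p).symm x)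
      (mfderiv 𝓘(ℝ, E) I (extChartAt I p).symm x v) = v := by
  have h := mfderiv_comp x (mdifferentiableAt_extChartAt' ((extChartAt I p).map_target hx))
    (mdifferentiableAt_extChartAt_symm hx)
  have h' : extChartAt I p ∘ (extChartAt I p).symm =ᶠ[𝓝 x] id := by
    filter_upwards [(isOpen_extChartAt_target p).mem_nhds hx] with y hy
    exact (extChartAt I p).right_inv hy
  rw [h'.mfderiv_eq, mfderiv_id] at h
  exact (DFunLike.congr_fun h v).symm

theorem mfderiv_symm_comp_mfderiv_extChartAt [I.Boundaryless] [IsManifold I ∞ X] {p q : X}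
    (hq : q ∈ (extChartAt I p).source) (v : TangentSpace I q) :
    (mfderiv 𝓘(ℝ, E) I (extChartAt I p).symm (extChartAt I p q)
      (mfderiv I 𝓘(ℝ, E) (extChartAt I p) q v) : E) = v := by
  have h := mfderiv_comp q
    (mdifferentiableAt_extChartAt_symm ((extChartAt I p).map_source hq))
    (mdifferentiableAt_extChartAt' hq)
  have h' : (extChartAt I p).symm ∘ extChartAt I p =ᶠ[𝓝 q] id := by
    filter_upwards [(isOpen_extChartAt_source p).mem_nhds hq] with y hy
    exact (extChartAt I p).left_inv hy
  rw [h'.mfderiv_eq, mfderiv_id] at h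
  exact (DFunLike.congr_fun h v).symm

/-- The local expression of a pullback is the pullback of the local expression. -/
theorem inChart_pullback_eventuallyEq [I.Boundaryless] [J.Boundaryless]
    [IsManifold I ∞ X] [IsManifold J ∞ Y] {f : X → Y} {U : Set X} (hU : IsOpen U)
    (hf : ContMDiffOn I J ∞ f U) (θ : Form J Y k) {p : X} {q : Y} {x : E}
    (hx : x ∈ (extChartAt I p).target) (hxU : (extChartAt I p).symm x ∈ U)
    (hq : f ((extChartAt I p).symm x) ∈ (extChartAt J q).source) :
    inChart (pullback (I := I) f θ) p =ᶠ[𝓝 x] fun z =>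
      (inChart θ q (extChartAt J q (f ((extChartAt I p).symm z)))).compContinuousLinearMap
        (fderiv ℝ (fun z => extChartAt J q (f ((extChartAt I p).symm z))) z) := by
  have hc : ContinuousAt (extChartAt I p).symm x := (mdifferentiableAt_extChartAt_symm hx).continuousAt
  have hfc : ContinuousAt f ((extChartAt I p).symm x) :=
    (hf.continuousOn).continuousAt (hU.mem_nhds hxU)
  filter_upwards [(isOpen_extChartAt_target p).mem_nhds hx, hc.preimage_mem_nhds (hU.mem_nhds hxU),
    (hfc.comp hc).preimage_mem_nhds ((isOpen_extChartAt_source q).mem_nhds hq)] with z hz hzU hzq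
  have hzq' : f ((extChartAt I p).symm z) ∈ (extChartAt J q).source := hzq
  have h1 := mdifferentiableAt_extChartAt_symm hz
  have h2 : MDifferentiableAt I J f ((extChartAt I p).symm z) :=
    (hf.contMDiffAt (hU.mem_nhds hzU)).mdifferentiableAt (by simp)
  have h3 := mdifferentiableAt_extChartAt' hzq'
  -- Chain rule, with `ψ⁻¹ ∘ ψ` cancelling: `dψ⁻¹ ∘ d(ψ ∘ f ∘ φ⁻¹) = df ∘ dφ⁻¹`.
  have key : ∀ v : E, (mfderiv 𝓘(ℝ, E') J (extChartAt J q).symm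
      (extChartAt J q (f ((extChartAt I p).symm z)))
      (fderiv ℝ (fun z => extChartAt J q (f ((extChartAt I p).symm z))) z v) : E') =
      mfderiv I J f ((extChartAt I p).symm z) (mfderiv 𝓘(ℝ, E) I (extChartAt I p).symm z v) := by
    intro v
    rw [← mfderiv_eq_fderiv]
    have e : mfderiv 𝓘(ℝ, E) 𝓘(ℝ, E') (fun z => extChartAt J q (f ((extChartAt I p).symm z))) z =
      (mfderiv J 𝓘(ℝ, E') (extChartAt J q) (f ((extChartAt I p).symm z))).comp
      ((mfderiv I J f ((extChartAt I p).symm z)).comp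
        (mfderiv 𝓘(ℝ, E) I (extChartAt I p).symm z)) := by
      rw [← mfderiv_comp z h2 h1]; exact mfderiv_comp z h3 (h2.comp z h1)
    rw [e]
    exact mfderiv_symm_comp_mfderiv_extChartAt hzq' _
  ext v
  refine Eq.trans ?_ (Form.apply_congr θ ((extChartAt J q).left_inv hzq').symm _)
  exact congrArg (θ (f ((extChartAt I p).symm z)) : E' [⋀^Fin k]→L[ℝ] ℝ)
    (funext fun i => (key (v i)).symm)

theorem pullback_id (θ : Form I X k) : pullback (I := I) id θ = θ := by
  funext p
  ext v
  simp only [pullback, mfderiv_id]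
  rfl

theorem contDiffAt_chartExpression [I.Boundaryless] [IsManifold I ∞ X] [IsManifold J ∞ Y]
    {f : X → Y} {U : Set X} (hU : IsOpen U) (hf : ContMDiffOn I J ∞ f U) {p : X} {q : Y} {x : E}
    (hx : x ∈ (extChartAt I p).target) (hxU : (extChartAt I p).symm x ∈ U)
    (hq : f ((extChartAt I p).symm x) ∈ (extChartAt J q).source) :
    ContDiffAt ℝ ∞ (fun z => extChartAt J q (f ((extChartAt I p).symm z))) x := by
  rw [← contMDiffAt_iff_contDiffAt]
  have h1 := (contMDiffOn_extChartAt_symm (n := ∞) p).contMDiffAt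
    ((isOpen_extChartAt_target (I := I) p).mem_nhds hx)
  have h2 := hf.contMDiffAt (hU.mem_nhds hxU)
  have h3 := contMDiffAt_extChartAt' (I := J) (n := ∞) (by simpa using hq)
  exact h3.comp x (h2.comp x h1)

theorem IsSmoothOn.contDiffAt [I.Boundaryless] [IsManifold I ∞ X] {θ : Form I X k} {U : Set X}
    (hU : IsOpen U) (h : IsSmoothOn θ U) {p : X} {x : E} (hx : x ∈ (extChartAt I p).target)
    (hxU : (extChartAt I p).symm x ∈ U) : ContDiffAt ℝ ∞ (inChart θ p) x := by
  refine (h p).contDiffAt (Filter.inter_mem ((isOpen_extChartAt_target p).mem_nhds hx) ?_)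
  exact (mdifferentiableAt_extChartAt_symm hx).continuousAt.preimage_mem_nhds (hU.mem_nhds hxU)

/-- Chart independence of `d`: `extDer` uses a different chart at each point, and a transition map
is the chart expression of the identity, so naturality of `extDeriv` under it compares the two
charts. -/
theorem inChart_extDer [I.Boundaryless] [IsManifold I ∞ X] {θ : Form I X k} {U : Set X}
    (hU : IsOpen U) (h : IsSmoothOn θ U) {p : X} {x : E} (hx : x ∈ (extChartAt I p).target)
    (hxU : (extChartAt I p).symm x ∈ U) :
    inChart (extDer θ) p x = extDeriv (inChart θ p) x := by
  set q := (extChartAt I p).symm x with hqdef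
  have hq : id ((extChartAt I p).symm x) ∈ (extChartAt I q).source := mem_extChartAt_source q
  have e := inChart_pullback_eventuallyEq hU (contMDiffOn_id (n := ∞)) θ hx hxU hq
  rw [pullback_id] at e
  rw [e.extDeriv_eq]
  have hd : DifferentiableAt ℝ (inChart θ q) (extChartAt I q q) :=
    (h.contDiffAt hU (mem_extChartAt_target q) (by simpa using hxU)).differentiableAt (by simp)
  refine Eq.trans ?_ (extDeriv_pullback (r := ∞)
    (f := fun z => extChartAt I q (id ((extChartAt I p).symm z))) hd
    (contDiffAt_chartExpression hU contMDiffOn_id hx hxU hq) minSmoothness_two_le_infty).symm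
  ext v
  refine congrArg (extDeriv (inChart θ q) (extChartAt I q q)) (funext fun i => ?_)
  have := mfderiv_comp x (mdifferentiableAt_extChartAt' hq) (mdifferentiableAt_extChartAt_symm hx)
  simp only [Function.comp_def] at this
  simp only [id]
  rw [← mfderiv_eq_fderiv, this]
  rfl

theorem extDer_pullback [I.Boundaryless] [J.Boundaryless]
    [IsManifold I ∞ X] [IsManifold J ∞ Y] {f : X → Y} {U : Set X} {V : Set Y} (hU : IsOpen U)
    (hV : IsOpen V) (hf : ContMDiffOn I J ∞ f U) (hUV : MapsTo f U V) {θ : Form J Y k}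
    (h : IsSmoothOn θ V) {p : X} (hp : p ∈ U) :
    extDer (pullback (I := I) f θ) p = pullback f (extDer θ) p := by
  have hx := mem_extChartAt_target (I := I) p
  have hpp : (extChartAt I p).symm (extChartAt I p p) = p := extChartAt_to_inv p
  have hxU : (extChartAt I p).symm (extChartAt I p p) ∈ U := by rwa [hpp]
  have hq : f ((extChartAt I p).symm (extChartAt I p p)) ∈ (extChartAt J (f p)).source := by
    rw [hpp]; exact mem_extChartAt_source _
  have e := inChart_pullback_eventuallyEq hU hf θ hx hxU hq
  have hd : DifferentiableAt ℝ (inChart θ (f p))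
      (extChartAt J (f p) (f ((extChartAt I p).symm (extChartAt I p p)))) := by
    rw [hpp]
    exact (h.contDiffAt hV (mem_extChartAt_target (f p)) (by simpa using hUV hp)).differentiableAt
      (by simp)
  have h2 : MDifferentiableAt I J f p :=
    (hf.contMDiffAt (hU.mem_nhds hp)).mdifferentiableAt (by simp)
  have e2 := extDeriv_pullback (r := ∞)
    (f := fun z => extChartAt J (f p) (f ((extChartAt I p).symm z))) hd
    (contDiffAt_chartExpression hU hf hx hxU hq) minSmoothness_two_le_infty
  rw [← e.extDeriv_eq, hpp] at e2
  ext v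
  simp only [extDer, pullback]
  rw [e2]
  refine congrArg (extDeriv (inChart θ (f p)) (extChartAt J (f p) (f p))) (funext fun i => ?_)
  have h4 := mdifferentiableAt_extChartAt' (I := J) (mem_extChartAt_source (I := J) (f p))
  have h5 := mfderiv_comp p h4 h2
  have h6 := mfderiv_comp (I := I) (I' := 𝓘(ℝ, E)) (I'' := 𝓘(ℝ, E')) p
    (g := fun z => extChartAt J (f p) (f ((extChartAt I p).symm z)))
    ((contDiffAt_chartExpression hU hf hx hxU hq).contMDiffAt.mdifferentiableAt (by simp))
    (mdifferentiableAt_extChartAt' (I := I) (mem_extChartAt_source (I := I) p))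
  -- The chart at `p` cancels, so the derivative of the chart expression, composed with that of the
  -- chart, is `dψ ∘ df`.
  have h7 : (fun z => extChartAt J (f p) (f ((extChartAt I p).symm z))) ∘ (extChartAt I p)
      =ᶠ[𝓝 p] extChartAt J (f p) ∘ f := by
    filter_upwards [extChartAt_source_mem_nhds (I := I) p] with y hy
    simp only [Function.comp_apply, (extChartAt I p).left_inv hy]
  rw [h7.mfderiv_eq, h5] at h6
  rw [mfderiv_eq_fderiv] at h6
  exact (DFunLike.congr_fun h6 (v i)).symm

theorem extDer_congr [I.Boundaryless] [IsManifold I ∞ X] {θ θ' : Form I X k} {U : Set X}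
    (hU : IsOpen U) (h : ∀ p ∈ U, θ p = θ' p) {p : X} (hp : p ∈ U) :
    extDer θ p = extDer θ' p := by
  have : inChart θ p =ᶠ[𝓝 (extChartAt I p p)] inChart θ' p := by
    have hc := (mdifferentiableAt_extChartAt_symm (mem_extChartAt_target (I := I) p)).continuousAt
    filter_upwards [hc.preimage_mem_nhds (hU.mem_nhds (by simpa using hp))] with z hz
    simp only [inChart, h _ hz]
  simp only [extDer, this.extDeriv_eq]

theorem inChart_neg (θ : Form I X k) (p : X) : inChart (-θ) p = -inChart θ p := rfl

theorem extDer_neg (θ : Form I X k) : extDer (-θ) = -extDer θ := by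
  funext p
  have : extDeriv (-inChart θ p) (extChartAt I p p) = -extDeriv (inChart θ p) (extChartAt I p p) := by
    have := extDeriv_smul (-1 : ℝ) (inChart θ p) (x := extChartAt I p p)
    simpa using this
  simp only [extDer, inChart_neg, this]
  rfl

theorem IsSmoothOn.neg {θ : Form I X k} {U : Set X} (h : IsSmoothOn θ U) : IsSmoothOn (-θ) U :=
  fun p => (h p).neg

theorem IsSmoothOn.congr {θ θ' : Form I X k} {U : Set X} (h : IsSmoothOn θ U)
    (h' : ∀ p ∈ U, θ' p = θ p) : IsSmoothOn θ' U := fun p =>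
  (h p).congr fun x hx => by simp only [inChart, h' _ hx.2]

theorem IsSmoothOn.extDer [I.Boundaryless] [IsManifold I ∞ X] {θ : Form I X k} {U : Set X}
    (hU : IsOpen U) (h : IsSmoothOn θ U) : IsSmoothOn (extDer θ) U := by
  intro p x hx
  have hc : ContDiffAt ℝ ∞ (extDeriv (inChart θ p)) x := by
    have := (ContinuousAlternatingMap.alternatizeUncurryFinCLM ℝ E ℝ (n := k)).contDiff
      |>.contDiffAt.comp x ((h.contDiffAt hU hx.1 hx.2).fderiv_right (m := ∞) (by simp))
    exact this
  exact hc.contDiffWithinAt.congr (fun z hz => inChart_extDer hU h hz.1 hz.2)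
    (inChart_extDer hU h hx.1 hx.2)

theorem extDer_extDer [I.Boundaryless] [IsManifold I ∞ X] {θ : Form I X k} {U : Set X}
    (hU : IsOpen U) (h : IsSmoothOn θ U) {p : X} (hp : p ∈ U) : extDer (extDer θ) p = 0 := by
  have e : inChart (Finsler.extDer θ) p =ᶠ[𝓝 (extChartAt I p p)] extDeriv (inChart θ p) := by
    have hc := (mdifferentiableAt_extChartAt_symm (mem_extChartAt_target (I := I) p)).continuousAt
    filter_upwards [hc.preimage_mem_nhds (hU.mem_nhds (by simpa using hp)),
      (isOpen_extChartAt_target p).mem_nhds (mem_extChartAt_target (I := I) p)] with z hz hz'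
    exact inChart_extDer hU h hz' hz
  have : extDeriv (inChart (Finsler.extDer θ) p) (extChartAt I p p) = 0 := by
    rw [e.extDeriv_eq]
    exact extDeriv_extDeriv_apply (r := ∞)
      (h.contDiffAt hU (mem_extChartAt_target p) (by simpa using hp)) minSmoothness_two_le_infty
  ext v
  rw [Finsler.extDer, this]
  rfl

/-- The pullback of a smooth `1`-form by a smooth map is smooth. -/
theorem IsSmoothOn.pullback [I.Boundaryless] [J.Boundaryless]
    [IsManifold I ∞ X] [IsManifold J ∞ Y] {f : X → Y} {U : Set X} {V : Set Y} (hU : IsOpen U)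
    (hV : IsOpen V) (hf : ContMDiffOn I J ∞ f U) (hUV : MapsTo f U V) {θ : Form J Y 1}
    (h : IsSmoothOn θ V) : IsSmoothOn (pullback (I := I) f θ) U := by
  intro p x hx
  set q := f ((extChartAt I p).symm x) with hqdef
  have hq : f ((extChartAt I p).symm x) ∈ (extChartAt J q).source := mem_extChartAt_source q
  have e := inChart_pullback_eventuallyEq hU hf θ hx.1 hx.2 hq
  have hg := contDiffAt_chartExpression hU hf hx.1 hx.2 hq
  have hθ := h.contDiffAt hV (mem_extChartAt_target (I := J) q) (by simpa [hqdef] using hUV hx.2)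
  have hθg := hθ.comp x hg
  refine ContDiffAt.contDiffWithinAt (ContDiffAt.congr_of_eventuallyEq ?_ e)
  -- Seen as covectors, `1`-forms pull back by composition of continuous linear maps, which is
  -- smooth in both factors.
  let i : (E →L[ℝ] ℝ) ≃ₗᵢ[ℝ] (E [⋀^Fin 1]→L[ℝ] ℝ) := ContinuousAlternatingMap.ofSubsingletonLIE 0
  let j : (E' →L[ℝ] ℝ) ≃ₗᵢ[ℝ] (E' [⋀^Fin 1]→L[ℝ] ℝ) := ContinuousAlternatingMap.ofSubsingletonLIE 0
  have hl := (j.symm.contDiff (n := ∞)).contDiffAt.comp x hθg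
  have := (i.contDiff (n := ∞)).contDiffAt.comp x (hl.clm_comp (hg.fderiv_right (m := ∞) (by simp)))
  refine this.congr_of_eventuallyEq (Filter.Eventually.of_forall fun z => ?_)
  ext v
  exact congrArg (inChart θ q (extChartAt J q (f ((extChartAt I p).symm z))))
    (funext fun m => by rw [Subsingleton.elim m 0])

end FormCalculus

/-! ### Minkowski norms and the Legendre map on a fibre -/

section MinkowskiNorms

variable {V : Type*} [NormedAddCommGroup V] [NormedSpace ℝ V] {N : V → ℝ}

namespace IsMinkowskiNorm

theorem contDiffAt_sq (h : IsMinkowskiNorm N) {y : V} (hy : y ≠ 0) :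
    ContDiffAt ℝ ∞ (fun w => N w ^ 2) y :=
  (h.smooth.contDiffAt (isOpen_ne.mem_nhds hy)).pow 2

theorem hasFDerivAt_sq (h : IsMinkowskiNorm N) {y : V} (hy : y ≠ 0) :
    HasFDerivAt (fun w => N w ^ 2) (fderiv ℝ (fun w => N w ^ 2) y) y :=
  ((h.contDiffAt_sq hy).differentiableAt (by simp)).hasFDerivAt

theorem hasFDerivAt_fderiv_sq (h : IsMinkowskiNorm N) {y : V} (hy : y ≠ 0) :
    HasFDerivAt (fderiv ℝ fun w => N w ^ 2) ((2 : ℝ) • fundamentalTensor N y) y := by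
  have := (((h.contDiffAt_sq hy).fderiv_right (m := ∞) (by simp)).differentiableAt
    (by simp)).hasFDerivAt
  have e : (2 : ℝ) • fundamentalTensor N y =
      fderiv ℝ (fun z => fderiv ℝ (fun w => N w ^ 2) z) y := by
    rw [fundamentalTensor, smul_smul]; norm_num
  rwa [e]

theorem map_zero (h : IsMinkowskiNorm N) : N 0 = 0 := by
  have := h.homogeneous 2 0 (by norm_num)
  rw [smul_zero] at this
  linarith

/-- Differentiate `N (c • w) ^ 2 = c ^ 2 * N w ^ 2` in `w` and cancel one factor `c`. -/
theorem fderiv_sq_smul (h : IsMinkowskiNorm N) {c : ℝ} (hc : 0 < c) {y : V} (hy : y ≠ 0) :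
    fderiv ℝ (fun w => N w ^ 2) (c • y) = c • fderiv ℝ (fun w => N w ^ 2) y := by
  have h1 : HasFDerivAt (fun w => N (c • w) ^ 2) (c • fderiv ℝ (fun w => N w ^ 2) (c • y)) y := by
    have := (h.hasFDerivAt_sq (smul_ne_zero hc.ne' hy)).comp y
      ((hasFDerivAt_id y).const_smul c)
    refine this.congr_fderiv ?_
    ext v
    simp
  have h2 : HasFDerivAt (fun w => N (c • w) ^ 2) (c ^ 2 • fderiv ℝ (fun w => N w ^ 2) y) y := by
    have := (h.hasFDerivAt_sq hy).const_smul (c ^ 2)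
    refine this.congr_of_eventuallyEq (Filter.Eventually.of_forall fun w => ?_)
    simp only [h.homogeneous c w hc, mul_pow, smul_eq_mul, Pi.smul_apply]
  have := h1.unique h2
  rw [pow_two, mul_smul] at this
  exact smul_right_injective _ hc.ne' this

theorem fderiv_sq_self (h : IsMinkowskiNorm N) {y : V} (hy : y ≠ 0) :
    fderiv ℝ (fun w => N w ^ 2) y y = 2 * N y ^ 2 := by
  have hl : HasDerivAt (fun c : ℝ => c • y) y 1 := by
    simpa using (hasDerivAt_id (1 : ℝ)).smul_const y
  have h1 : HasDerivAt (fun c : ℝ => N (c • y) ^ 2) (fderiv ℝ (fun w => N w ^ 2) y y) 1 :=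
    HasFDerivAt.comp_hasDerivAt (x := (1 : ℝ)) (f := fun c : ℝ => c • y)
      (l := fun w => N w ^ 2) (by simpa using h.hasFDerivAt_sq hy) hl
  have h2 : HasDerivAt (fun c : ℝ => N (c • y) ^ 2) (2 * N y ^ 2) 1 := by
    have : HasDerivAt (fun c : ℝ => c ^ 2 * N y ^ 2) (2 * N y ^ 2) 1 := by
      simpa using (hasDerivAt_pow 2 (1 : ℝ)).mul_const (N y ^ 2)
    refine this.congr_of_eventuallyEq ?_
    filter_upwards [lt_mem_nhds (zero_lt_one' ℝ)] with c hc
    rw [h.homogeneous c y hc, mul_pow]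
  exact h1.unique h2

/-- Euler's relation for the differential of `N ^ 2`. -/
theorem fundamentalTensor_self (h : IsMinkowskiNorm N) {y : V} (hy : y ≠ 0) :
    fundamentalTensor N y y = (1 / 2 : ℝ) • fderiv ℝ (fun w => N w ^ 2) y := by
  have hl : HasDerivAt (fun c : ℝ => c • y) y 1 := by
    simpa using (hasDerivAt_id (1 : ℝ)).smul_const y
  have h1 : HasDerivAt (fun c : ℝ => fderiv ℝ (fun w => N w ^ 2) (c • y))
      (((2 : ℝ) • fundamentalTensor N y) y) 1 :=
    HasFDerivAt.comp_hasDerivAt (x := (1 : ℝ)) (f := fun c : ℝ => c • y)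
      (by simpa using h.hasFDerivAt_fderiv_sq hy) hl
  have h2 : HasDerivAt (fun c : ℝ => fderiv ℝ (fun w => N w ^ 2) (c • y))
      (fderiv ℝ (fun w => N w ^ 2) y) 1 := by
    have : HasDerivAt (fun c : ℝ => c • fderiv ℝ (fun w => N w ^ 2) y)
        (fderiv ℝ (fun w => N w ^ 2) y) 1 := by
      simpa using (hasDerivAt_id (1 : ℝ)).smul_const (fderiv ℝ (fun w => N w ^ 2) y)
    refine this.congr_of_eventuallyEq ?_
    filter_upwards [lt_mem_nhds (zero_lt_one' ℝ)] with c hc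
    exact h.fderiv_sq_smul hc hy
  rw [← h1.unique h2]
  simp [smul_smul]

theorem fundamentalTensor_self_self (h : IsMinkowskiNorm N) {y : V} (hy : y ≠ 0) :
    fundamentalTensor N y y y = N y ^ 2 := by
  rw [h.fundamentalTensor_self hy]
  simp [h.fderiv_sq_self hy]

theorem pos (h : IsMinkowskiNorm N) {y : V} (hy : y ≠ 0) : 0 < N y := by
  have := h.posDef y hy y hy
  rw [h.fundamentalTensor_self_self hy] at this
  exact (h.nonneg y).lt_of_ne fun h0 => by simp [← h0] at this

theorem fundamentalTensor_self_ne_zero (h : IsMinkowskiNorm N) {y : V} (hy : y ≠ 0) :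
    fundamentalTensor N y y ≠ 0 := fun h0 => by
  have := h.posDef y hy y hy
  simp [h0] at this

/-- Along the segment from `z` to `y`, the derivative of `N²` in the direction `y - z` has
derivative `2 g(y - z, y - z) > 0`, so its end values differ. Segments through `0`, where smoothness
is not available, are excluded separately by Euler's relation. -/
theorem eq_of_fderiv_sq_eq (h : IsMinkowskiNorm N) {y z : V} (hy : y ≠ 0) (hz : z ≠ 0)
    (hyz : fderiv ℝ (fun w => N w ^ 2) y = fderiv ℝ (fun w => N w ^ 2) z) : y = z := by
  by_contra hne
  by_cases hseg : ∃ t ∈ Icc (0 : ℝ) 1, z + t • (y - z) = 0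
  · obtain ⟨t, ht, h0⟩ := hseg
    -- The common differential takes the values `2 N(y)²` at `y` and `2 N(z)²` at `z`, so the
    -- relation becomes `(1 - t) N(z)² + t N(y)² = 0`, a vanishing convex combination of positive
    -- numbers.
    have e := congrArg (fderiv ℝ (fun w => N w ^ 2) y) h0
    have hzz := h.fderiv_sq_self hz
    rw [← hyz] at hzz
    simp only [map_add, map_smul, map_sub, h.fderiv_sq_self hy, hzz, smul_eq_mul,
      _root_.map_zero] at e
    have h1 := pow_pos (h.pos hy) 2
    have h2 := pow_pos (h.pos hz) 2
    rcases eq_or_lt_of_le ht.1 with rfl | ht0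
    · simp at e; exact h2.ne' (by simp [e])
    · nlinarith [mul_pos ht0 h1, mul_nonneg (sub_nonneg.2 ht.2) h2.le]
  · push Not at hseg
    have hd : ∀ t ∈ Icc (0 : ℝ) 1,
        HasDerivAt (fun t : ℝ => fderiv ℝ (fun w => N w ^ 2) (z + t • (y - z)) (y - z))
          (((2 : ℝ) • fundamentalTensor N (z + t • (y - z))) (y - z) (y - z)) t := by
      intro t ht
      have hl : HasDerivAt (fun t : ℝ => z + t • (y - z)) (y - z) t := by
        simpa using ((hasDerivAt_id t).smul_const (y - z)).const_add z
      have := (h.hasFDerivAt_fderiv_sq (hseg t ht)).comp_hasDerivAt t hl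
      exact this.clm_apply (hasDerivAt_const t (y - z)) |>.congr_deriv (by simp)
    have hmono : StrictMonoOn
        (fun t : ℝ => fderiv ℝ (fun w => N w ^ 2) (z + t • (y - z)) (y - z)) (Icc 0 1) := by
      refine strictMonoOn_of_deriv_pos (convex_Icc 0 1)
        (fun t ht => (hd t ht).continuousAt.continuousWithinAt) fun t ht => ?_
      have ht' := interior_subset ht
      rw [(hd t ht').deriv]
      have := h.posDef _ (hseg t ht') (y - z) (sub_ne_zero.2 hne)
      simpa using this
    have := hmono (left_mem_Icc.2 zero_le_one) (right_mem_Icc.2 zero_le_one) one_pos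
    simp [hyz] at this

theorem fundamentalTensor_self_injOn (h : IsMinkowskiNorm N) :
    InjOn (fun y => fundamentalTensor N y y) {y | y ≠ 0} := by
  intro y hy z hz hyz
  simp only [h.fundamentalTensor_self hy, h.fundamentalTensor_self hz] at hyz
  exact h.eq_of_fderiv_sq_eq hy hz (smul_right_injective _ (by norm_num : (1 / 2 : ℝ) ≠ 0) hyz)

variable [FiniteDimensional ℝ V]

/-- Extrema of `N` on the compact unit sphere, nonempty by nontriviality, spread to all vectors by
homogeneity. -/
theorem exists_bounds [Nontrivial V] (h : IsMinkowskiNorm N) :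
    ∃ m C : ℝ, 0 < m ∧ ∀ y, m * ‖y‖ ≤ N y ∧ N y ≤ C * ‖y‖ := by
  have hc : IsCompact (Metric.sphere (0 : V) 1) := isCompact_sphere 0 1
  have hne : (Metric.sphere (0 : V) 1).Nonempty := NormedSpace.sphere_nonempty.2 zero_le_one
  have hs : ∀ y ∈ Metric.sphere (0 : V) 1, y ≠ 0 := fun y hy =>
    ne_zero_of_mem_unit_sphere ⟨y, hy⟩
  have hcont : ContinuousOn N (Metric.sphere (0 : V) 1) := h.smooth.continuousOn.mono hs
  obtain ⟨a, ha, hamin⟩ := hc.exists_isMinOn hne hcont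
  obtain ⟨b, hb, hbmax⟩ := hc.exists_isMaxOn hne hcont
  refine ⟨N a, N b, h.pos (hs a ha), fun y => ?_⟩
  rcases eq_or_ne y 0 with rfl | hy
  · simp [h.map_zero]
  have hy' := norm_pos_iff.2 hy
  have hmem : ‖y‖⁻¹ • y ∈ Metric.sphere (0 : V) 1 := by
    simp [norm_smul, hy'.ne']
  have e : N y = N (‖y‖⁻¹ • y) * ‖y‖ := by
    rw [h.homogeneous _ _ (inv_pos.2 hy')]; field_simp
  rw [e]
  exact ⟨mul_le_mul_of_nonneg_right (hamin hmem) hy'.le,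
    mul_le_mul_of_nonneg_right (hbmax hmem) hy'.le⟩

theorem continuous [Nontrivial V] (h : IsMinkowskiNorm N) : Continuous N := by
  rw [continuous_iff_continuousAt]
  intro y
  rcases eq_or_ne y 0 with rfl | hy
  · obtain ⟨m, C, -, hb⟩ := h.exists_bounds
    rw [ContinuousAt, h.map_zero]
    refine squeeze_zero h.nonneg (fun y => (hb y).2) ?_
    have : Continuous fun y : V => C * ‖y‖ := by fun_prop
    simpa using this.tendsto 0
  · exact (h.smooth.contDiffAt (isOpen_ne.mem_nhds hy)).continuousAt

/-- A minimiser of `N² - 2ξ` exists by coercivity. It is not `0`, hence it is a critical point,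
where `d(N²) = 2ξ`; Euler's relation rewrites this as the claim. -/
theorem exists_fundamentalTensor_self_eq (h : IsMinkowskiNorm N) {ξ : V →L[ℝ] ℝ} (hξ : ξ ≠ 0) :
    ∃ y, y ≠ 0 ∧ fundamentalTensor N y y = ξ := by
  obtain ⟨v, hv⟩ : ∃ v, 0 < ξ v := by
    by_contra! hneg
    refine hξ (ContinuousLinearMap.ext fun v => le_antisymm (hneg v) ?_)
    have := hneg (-v)
    rw [map_neg] at this
    simpa using this
  have hv0 : v ≠ 0 := fun h0 => by simp [h0] at hv
  have : Nontrivial V := ⟨v, 0, hv0⟩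
  obtain ⟨m, C, hm, hb⟩ := h.exists_bounds
  have hcont : Continuous fun y => N y ^ 2 - 2 * ξ y := by
    have := h.continuous
    fun_prop
  have hlow : ∀ y, m ^ 2 * ‖y‖ ^ 2 - 2 * ‖ξ‖ * ‖y‖ ≤ N y ^ 2 - 2 * ξ y := by
    intro y
    have h1 : (m * ‖y‖) ^ 2 ≤ N y ^ 2 := pow_le_pow_left₀ (by positivity) (hb y).1 2
    have h2 := (le_abs_self _).trans (ξ.le_opNorm y)
    nlinarith
  -- Beyond the radius `2‖ξ‖ / m²` the lower bound is nonnegative, hence at least the value at the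
  -- origin.
  obtain ⟨y, hy⟩ := hcont.exists_forall_le' (0 : V) (by
    filter_upwards [(tendsto_norm_cocompact_atTop (E := V)).eventually_ge_atTop
      (2 * ‖ξ‖ / m ^ 2)] with y hy
    refine le_trans ?_ (hlow y)
    rw [div_le_iff₀ (by positivity)] at hy
    simp only [h.map_zero, _root_.map_zero]
    nlinarith [norm_nonneg y])
  have hy0 : y ≠ 0 := by
    rintro rfl
    simp only [h.map_zero, _root_.map_zero] at hy
    have hN := h.pos hv0
    -- This factor minimises `t² N(v)² - 2 t ξ(v)` on the ray through `v`; the value there, `-ξ(v)²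
    -- / N(v)²`, is below the value `0` at the origin.
    have ht : 0 < ξ v / N v ^ 2 := by positivity
    have := hy ((ξ v / N v ^ 2) • v)
    rw [h.homogeneous _ _ ht, map_smul, smul_eq_mul] at this
    have e : (ξ v / N v ^ 2 * N v) ^ 2 - 2 * (ξ v / N v ^ 2 * ξ v) = -(ξ v ^ 2 / N v ^ 2) := by
      field_simp; ring
    rw [e] at this
    have : 0 < ξ v ^ 2 / N v ^ 2 := by positivity
    linarith
  refine ⟨y, hy0, ?_⟩
  have hmin : IsLocalMin (fun y => N y ^ 2 - 2 * ξ y) y := Filter.Eventually.of_forall hy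
  have hd := (h.hasFDerivAt_sq hy0).sub ((ξ.hasFDerivAt (x := y)).const_smul (2 : ℝ))
  have := hmin.hasFDerivAt_eq_zero hd
  rw [h.fundamentalTensor_self hy0, sub_eq_zero.1 this, smul_smul]
  norm_num

end IsMinkowskiNorm

variable {W : Type*} [NormedAddCommGroup W] [NormedSpace ℝ W]

/-- The chain rule applied twice; as `B` is linear, no term with a second derivative of `B` appears.
-/
theorem IsMinkowskiNorm.fundamentalTensor_comp (h : IsMinkowskiNorm N) (B : W ≃L[ℝ] V) {w : W}
    (hw : w ≠ 0) (a b : W) :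
    fundamentalTensor (fun w => N (B w)) w a b = fundamentalTensor N (B w) (B a) (B b) := by
  have hB : ∀ {w : W}, w ≠ 0 → B w ≠ 0 := fun hw => by simpa using hw
  have e : (fderiv ℝ fun w => N (B w) ^ 2) =ᶠ[𝓝 w] fun w =>
      (ContinuousLinearMap.compL ℝ W V ℝ).flip (B : W →L[ℝ] V)
        (fderiv ℝ (fun w => N w ^ 2) (B w)) := by
    filter_upwards [isOpen_ne.mem_nhds hw] with z hz
    exact ((h.hasFDerivAt_sq (hB hz)).comp z B.hasFDerivAt).fderiv
  have h2 := ((ContinuousLinearMap.compL ℝ W V ℝ).flip (B : W →L[ℝ] V)).hasFDerivAt.comp w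
    ((h.hasFDerivAt_fderiv_sq (hB hw)).comp w B.hasFDerivAt)
  rw [fundamentalTensor, (h2.congr_of_eventuallyEq e).fderiv]
  simp

theorem IsMinkowskiNorm.comp (h : IsMinkowskiNorm N) (B : W ≃L[ℝ] V) :
    IsMinkowskiNorm fun w => N (B w) where
  nonneg _ := h.nonneg _
  smooth := h.smooth.comp B.contDiff.contDiffOn fun w hw => by simpa using hw
  homogeneous c w hc := by rw [map_smul, h.homogeneous c _ hc]
  posDef w hw u hu := by
    rw [h.fundamentalTensor_comp B hw]
    exact h.posDef _ (by simpa using hw) _ (by simpa using hu)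

/-- The fibrewise differential of half the square of a function of a base point and a vector. -/
def fiberLegendre (F : W × V → ℝ) (z : W × V) : W × (V →L[ℝ] ℝ) :=
  (z.1, (1 / 2 : ℝ) • (fderiv ℝ (fun z => F z ^ 2) z).comp (ContinuousLinearMap.inr ℝ W V))

theorem contDiffAt_fiberLegendre {F : W × V → ℝ} {z : W × V} (hF : ContDiffAt ℝ ∞ F z) :
    ContDiffAt ℝ ∞ (fiberLegendre F) z :=
  contDiffAt_fst.prodMk
    ((((hF.pow 2).fderiv_right (m := ∞) (by simp)).clm_comp contDiffAt_const).const_smul (1 / 2 : ℝ))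

/-- Euler's relation on the fibre. It replaces `g_y(y, ·)` by a first derivative whose smoothness
jointly in base point and vector is immediate. -/
theorem fiberLegendre_eq {F : W × V → ℝ} {z : W × V} (hF : DifferentiableAt ℝ F z)
    (hN : IsMinkowskiNorm fun v => F (z.1, v)) (hz : z.2 ≠ 0) :
    fiberLegendre F z = (z.1, fundamentalTensor (fun v => F (z.1, v)) z.2 z.2) := by
  rw [hN.fundamentalTensor_self hz, fiberLegendre]
  have h1 : HasFDerivAt (fun z => F z ^ 2) (fderiv ℝ (fun z => F z ^ 2) z) (z.1, z.2) :=
    (hF.pow 2).hasFDerivAt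
  have := h1.comp z.2 (hasFDerivAt_prodMk_right z.1 z.2)
  rw [show fderiv ℝ (fun v => F (z.1, v) ^ 2) z.2 = _ from this.fderiv]

/-- The derivative is the identity on base components, so a kernel vector is vertical, `(0, v)`. The
fibre block is the fundamental tensor, hence `g(v, v) = 0` and `v = 0`. -/
theorem fderiv_fiberLegendre_injective {F : W × V → ℝ} {z : W × V} (hF : ContDiffAt ℝ ∞ F z)
    (hN : IsMinkowskiNorm fun v => F (z.1, v)) (hz : z.2 ≠ 0) :
    Function.Injective (fderiv ℝ (fiberLegendre F) z) := by
  have hd : HasFDerivAt (fiberLegendre F) (fderiv ℝ (fiberLegendre F) z) (z.1, z.2) :=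
    ((contDiffAt_fiberLegendre hF).differentiableAt (by simp)).hasFDerivAt
  have h1 : ∀ a, (fderiv ℝ (fiberLegendre F) z a).1 = a.1 := by
    intro a
    have e : HasFDerivAt (fun z => (fiberLegendre F z).1) _ z := hd.fst
    have := e.unique hasFDerivAt_fst
    exact DFunLike.congr_fun this a
  rw [injective_iff_map_eq_zero]
  rintro ⟨a, v⟩ hav
  have ha : a = 0 := by simpa [hav] using (h1 (a, v)).symm
  subst ha
  have h2 := (hd.comp z.2 (hasFDerivAt_prodMk_right z.1 z.2)).snd
  have hev : (fun v => ((fiberLegendre F ∘ fun v => (z.1, v)) v).2) =ᶠ[𝓝 z.2]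
      fun v => (1 / 2 : ℝ) • fderiv ℝ (fun v => F (z.1, v) ^ 2) v := by
    have hc : ContinuousAt (fun v => (z.1, v)) z.2 := by fun_prop
    have hFe : ∀ᶠ x in 𝓝 (z.1, z.2), DifferentiableAt ℝ F x :=
      ((hF.of_le (m := 1) (by simp)).eventually (by simp)).mono fun x hx =>
        hx.differentiableAt one_ne_zero
    filter_upwards [isOpen_ne.mem_nhds hz, hc.eventually hFe] with v hv hFv
    have := fiberLegendre_eq (z := (z.1, v)) hFv hN hv
    simp only [Function.comp, this, hN.fundamentalTensor_self hv]
  have h3 := ((hN.hasFDerivAt_fderiv_sq hz).const_smul (1 / 2 : ℝ)).congr_of_eventuallyEq hev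
  have h4 := DFunLike.congr_fun (DFunLike.congr_fun (h3.unique h2) v) v
  have h5 : fundamentalTensor (fun v => F (z.1, v)) z.2 v v = 0 := by
    simpa [hav, smul_smul] using h4
  by_contra hne
  have hv : v ≠ 0 := fun h0 => hne (by simp [h0])
  exact (hN.posDef _ hz v hv).ne' h5

end MinkowskiNorms

/-- Trivialisations are linear isomorphisms on fibres, so locally this is the condition of a nonzero
second component. -/
theorem isOpen_snd_ne_zero {B F : Type*} {E : B → Type*} [NormedAddCommGroup F] [NormedSpace ℝ F]
    [TopologicalSpace B] [∀ x, AddCommGroup (E x)] [∀ x, Module ℝ (E x)]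
    [∀ x, TopologicalSpace (E x)] [TopologicalSpace (TotalSpace F E)] [FiberBundle F E]
    [VectorBundle ℝ F E] : IsOpen {p : TotalSpace F E | p.snd ≠ 0} := by
  rw [isOpen_iff_mem_nhds]
  intro p hp
  set e := trivializationAt F E p.proj
  have key : ∀ q ∈ e.source, ((e q).2 ≠ 0 ↔ q.snd ≠ 0) := fun q hq => by
    have h := e.continuousLinearEquivAt_apply' (R := ℝ) q hq
    rw [← h, Ne, Ne, ContinuousLinearEquiv.map_eq_zero_iff]
  have hps : p ∈ e.source := e.mem_source.2 (FiberBundle.mem_baseSet_trivializationAt' p.proj)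
  have ho : IsOpen (e.source ∩ e ⁻¹' {z | z.2 ≠ 0}) :=
    e.continuousOn.isOpen_inter_preimage e.open_source
      (isOpen_ne.preimage continuous_snd)
  filter_upwards [ho.mem_nhds ⟨hps, (key p hps).2 hp⟩] with q hq
  exact (key q hq.1).1 hq.2

/-! ### Bundle charts of the tangent and cotangent bundles -/

section BundleCharts

variable {n : ℕ} {M : Type*} [TopologicalSpace M] [ChartedSpace (EuclideanSpace ℝ (Fin n)) M]
  [IsManifold (𝓡 n) ∞ M]

theorem isOpen_slitTangent : IsOpen (slitTangent n M) := isOpen_snd_ne_zero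

theorem isOpen_slitCotangent : IsOpen (slitCotangent n M) := isOpen_snd_ne_zero

/-- The identification of the tangent space at `x` with the model space given by the chart at
`x₀`. -/
def tangentCoord {x₀ x : M} (hx : x ∈ (chartAt (EuclideanSpace ℝ (Fin n)) x₀).source) :
    EuclideanSpace ℝ (Fin n) ≃L[ℝ] EuclideanSpace ℝ (Fin n) :=
  (trivializationAt (EuclideanSpace ℝ (Fin n)) (TangentSpace (𝓡 n)) x₀).continuousLinearEquivAt ℝ x
    (by simpa using hx)

theorem tangentCoord_apply {x₀ x : M} (hx : x ∈ (chartAt (EuclideanSpace ℝ (Fin n)) x₀).source)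
    (v : TangentSpace (𝓡 n) x) :
    tangentCoord hx v = mfderiv (𝓡 n) 𝓘(ℝ, EuclideanSpace ℝ (Fin n)) (extChartAt (𝓡 n) x₀) x v := by
  rw [← TangentBundle.continuousLinearMapAt_trivializationAt (I := 𝓡 n) hx]
  exact congrFun (Trivialization.coe_continuousLinearEquivAt_eq (R := ℝ)
    (trivializationAt (EuclideanSpace ℝ (Fin n)) (TangentSpace (𝓡 n)) x₀) (by simpa using hx)) v

theorem mem_extChartAt_tangent_source {y p : TangentBundle (𝓡 n) M} :
    p ∈ (extChartAt (modelT n) y).source ↔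
      p.proj ∈ (chartAt (EuclideanSpace ℝ (Fin n)) y.proj).source := by
  rw [extChartAt_source]
  exact TangentBundle.mem_chart_source_iff p y

theorem mem_extChartAt_tangent_target {y : TangentBundle (𝓡 n) M}
    {z : EuclideanSpace ℝ (Fin n) × EuclideanSpace ℝ (Fin n)} :
    z ∈ (extChartAt (modelT n) y).target ↔ z.1 ∈ (extChartAt (𝓡 n) y.proj).target := by
  rw [FiberBundle.extChartAt_target]
  simp only [mem_prod, mem_inter_iff, mem_univ, and_true, and_iff_left_iff_imp]
  intro hz
  simpa using (extChartAt (𝓡 n) y.proj).map_target hz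

theorem extChartAt_tangent_apply {y p : TangentBundle (𝓡 n) M}
    (hp : p.proj ∈ (chartAt (EuclideanSpace ℝ (Fin n)) y.proj).source) :
    extChartAt (modelT n) y p = (extChartAt (𝓡 n) y.proj p.proj, tangentCoord hp p.snd) := by
  rw [FiberBundle.extChartAt]
  rfl

theorem mem_extChartAt_cotangent_source {ζ ξ : CotangentBundle n M} :
    ξ ∈ (extChartAt (modelCoT n) ζ).source ↔
      ξ.proj ∈ (chartAt (EuclideanSpace ℝ (Fin n)) ζ.proj).source := by
  rw [FiberBundle.extChartAt]
  simp only [PartialEquiv.trans_source, PartialEquiv.prod_source, PartialEquiv.refl_source,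
    mem_inter_iff, mem_preimage, mem_prod, mem_univ, and_true, extChartAt_source]
  refine ⟨fun h => h.2, fun h => ⟨?_, h⟩⟩
  simpa using! h

/-- Covectors are maps into the trivial line bundle, so their coordinates change contragrediently,
by precomposition with the inverse of the tangent coordinates. -/
theorem extChartAt_cotangent_apply {ζ ξ : CotangentBundle n M}
    (hξ : ξ.proj ∈ (chartAt (EuclideanSpace ℝ (Fin n)) ζ.proj).source) :
    extChartAt (modelCoT n) ζ ξ = (extChartAt (𝓡 n) ζ.proj ξ.proj,
      (ξ.snd : EuclideanSpace ℝ (Fin n) →L[ℝ] ℝ).comp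
        ((tangentCoord hξ).symm : EuclideanSpace ℝ (Fin n) →L[ℝ] EuclideanSpace ℝ (Fin n))) := by
  rw [FiberBundle.extChartAt]
  refine Prod.ext rfl ?_
  ext v
  change ContinuousLinearMap.inCoordinates _ _ _ _ _ _ _ _ ξ.snd v = _
  rw [ContinuousLinearMap.inCoordinates_eq (by simpa using hξ) (by simp)]
  rfl

theorem extChartAt_tangent_symm_apply {y : TangentBundle (𝓡 n) M}
    {z : EuclideanSpace ℝ (Fin n) × EuclideanSpace ℝ (Fin n)}
    (hz : z.1 ∈ (extChartAt (𝓡 n) y.proj).target)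
    (hx : (extChartAt (𝓡 n) y.proj).symm z.1 ∈
      (chartAt (EuclideanSpace ℝ (Fin n)) y.proj).source) :
    (extChartAt (modelT n) y).symm z =
      ⟨(extChartAt (𝓡 n) y.proj).symm z.1, (tangentCoord hx).symm z.2⟩ := by
  refine ((PartialEquiv.eq_symm_apply _ (mem_extChartAt_tangent_source.2 hx)
    (mem_extChartAt_tangent_target.2 hz)).2 ?_).symm
  rw [extChartAt_tangent_apply hx, (extChartAt (𝓡 n) y.proj).right_inv hz]
  exact Prod.ext rfl ((tangentCoord hx).apply_symm_apply z.2)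

omit [IsManifold (𝓡 n) ∞ M] in
theorem extChartAt_symm_mem_chart_source {x₀ : M} {x : EuclideanSpace ℝ (Fin n)}
    (hx : x ∈ (extChartAt (𝓡 n) x₀).target) :
    (extChartAt (𝓡 n) x₀).symm x ∈ (chartAt (EuclideanSpace ℝ (Fin n)) x₀).source := by
  simpa using (extChartAt (𝓡 n) x₀).map_target hx

end BundleCharts

/-! ### The Legendre transformation is a diffeomorphism -/

section Legendre

variable {n : ℕ} {M : Type*} [TopologicalSpace M] [ChartedSpace (EuclideanSpace ℝ (Fin n)) M]
  [IsManifold (𝓡 n) ∞ M] {L : TangentBundle (𝓡 n) M → ℝ}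

theorem extChartAt_tangent_symm_mem_slitTangent {y : TangentBundle (𝓡 n) M}
    {z : EuclideanSpace ℝ (Fin n) × EuclideanSpace ℝ (Fin n)}
    (hz : z ∈ (extChartAt (modelT n) y).target) (hz2 : z.2 ≠ 0) :
    (extChartAt (modelT n) y).symm z ∈ slitTangent n M := by
  have hz' := mem_extChartAt_tangent_target.1 hz
  have hx := extChartAt_symm_mem_chart_source hz'
  rw [extChartAt_tangent_symm_apply hz' hx]
  exact fun h0 => hz2 ((ContinuousLinearEquiv.map_eq_zero_iff (tangentCoord hx).symm).1 h0)

theorem extChartAt_tangent_snd_ne_zero {y p : TangentBundle (𝓡 n) M}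
    (hp : p ∈ (extChartAt (modelT n) y).source) (hps : p ∈ slitTangent n M) :
    (extChartAt (modelT n) y p).2 ≠ 0 := by
  have hp' := mem_extChartAt_tangent_source.1 hp
  rw [extChartAt_tangent_apply hp']
  exact fun h0 => hps ((ContinuousLinearEquiv.map_eq_zero_iff (tangentCoord hp')).1 h0)

namespace IsFinslerNorm

theorem contDiffAt_chart (hL : IsFinslerNorm L) {y : TangentBundle (𝓡 n) M}
    {z : EuclideanSpace ℝ (Fin n) × EuclideanSpace ℝ (Fin n)}
    (hz : z ∈ (extChartAt (modelT n) y).target) (hz2 : z.2 ≠ 0) :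
    ContDiffAt ℝ ∞ (fun z => L ((extChartAt (modelT n) y).symm z)) z :=
  contDiffAt_chartExpression (J := 𝓘(ℝ, ℝ)) (q := (0 : ℝ)) isOpen_slitTangent hL.smooth hz
    (extChartAt_tangent_symm_mem_slitTangent hz hz2)
    (by rw [extChartAt_model_space_eq_id]; exact mem_univ _)

theorem isMinkowskiNorm_chart (hL : IsFinslerNorm L) {y : TangentBundle (𝓡 n) M}
    {x : EuclideanSpace ℝ (Fin n)} (hx : x ∈ (extChartAt (𝓡 n) y.proj).target) :
    IsMinkowskiNorm fun v : EuclideanSpace ℝ (Fin n) =>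
      L ((extChartAt (modelT n) y).symm (x, v)) := by
  have hx' := extChartAt_symm_mem_chart_source hx
  have := (hL.minkowski ((extChartAt (𝓡 n) y.proj).symm x)).comp (tangentCoord hx').symm
  convert this using 2 with v
  rw [extChartAt_tangent_symm_apply (z := (x, v)) hx hx']
  rfl

/-- The expression of the Legendre transformation in charts. -/
theorem extChartAt_legendre (hL : IsFinslerNorm L) {y : TangentBundle (𝓡 n) M}
    {z : EuclideanSpace ℝ (Fin n) × EuclideanSpace ℝ (Fin n)}
    (hz : z ∈ (extChartAt (modelT n) y).target) (hz2 : z.2 ≠ 0) :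
    extChartAt (modelCoT n) (legendre L y) (legendre L ((extChartAt (modelT n) y).symm z)) =
      fiberLegendre (fun z => L ((extChartAt (modelT n) y).symm z)) z := by
  have hz' := mem_extChartAt_tangent_target.1 hz
  have hx := extChartAt_symm_mem_chart_source hz'
  rw [fiberLegendre_eq ((hL.contDiffAt_chart hz hz2).differentiableAt (by simp))
    (hL.isMinkowskiNorm_chart hz') hz2, extChartAt_tangent_symm_apply hz' hx]
  refine (extChartAt_cotangent_apply (ζ := legendre L y)
    (ξ := legendre L ⟨_, (tangentCoord hx).symm z.2⟩) hx).trans ?_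
  refine Prod.ext ((extChartAt (𝓡 n) y.proj).right_inv hz') ?_
  have e : (fun v => L ((extChartAt (modelT n) y).symm (z.1, v))) = fun v =>
      fiberRestrict L ((extChartAt (𝓡 n) y.proj).symm z.1) ((tangentCoord hx).symm v) := by
    funext v
    rw [extChartAt_tangent_symm_apply (z := (z.1, v)) hz' hx]
    rfl
  ext v
  simp only [e]
  -- The fundamental tensor transforms by the same inverse tangent coordinates as the covector.
  rw [(hL.minkowski _).fundamentalTensor_comp (tangentCoord hx).symm hz2]
  rfl

theorem legendre_mem_slitCotangent (hL : IsFinslerNorm L) :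
    MapsTo (legendre L) (slitTangent n M) (slitCotangent n M) := fun y hy =>
  (hL.minkowski y.proj).fundamentalTensor_self_ne_zero hy

theorem bijOn_legendre (hL : IsFinslerNorm L) :
    BijOn (legendre L) (slitTangent n M) (slitCotangent n M) := by
  refine ⟨hL.legendre_mem_slitCotangent, ?_, ?_⟩
  · rintro ⟨x, v⟩ hv ⟨x', v'⟩ hv' h
    obtain rfl : x = x' := congrArg TotalSpace.proj h
    have h2 := TotalSpace.mk_injective x h
    exact congrArg (TotalSpace.mk x) ((hL.minkowski x).fundamentalTensor_self_injOn hv hv' h2)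
  · rintro ⟨x, ξ⟩ hξ
    obtain ⟨v, hv, h⟩ := (hL.minkowski x).exists_fundamentalTensor_self_eq (ξ := ξ) hξ
    exact ⟨⟨x, v⟩, hv, congrArg (TotalSpace.mk x) h⟩

theorem contMDiffOn_legendre (hL : IsFinslerNorm L) :
    ContMDiffOn (modelT n) (modelCoT n) ∞ (legendre L) (slitTangent n M) := by
  intro y hy
  have hyt := mem_extChartAt_target (I := modelT n) y
  have h1 := contMDiffAt_extChartAt (I := modelT n) (n := ∞) (x := y)
  have h2 := (contDiffAt_fiberLegendre (hL.contDiffAt_chart hyt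
    (extChartAt_tangent_snd_ne_zero (mem_extChartAt_source y) hy))).contMDiffAt
  have e : ∀ p ∈ (extChartAt (modelT n) y).source, p ∈ slitTangent n M →
      legendre L p = (extChartAt (modelCoT n) (legendre L y)).symm
        (fiberLegendre (fun z => L ((extChartAt (modelT n) y).symm z))
          (extChartAt (modelT n) y p)) := by
    intro p hp hps
    rw [← hL.extChartAt_legendre ((extChartAt (modelT n) y).map_source hp)
      (extChartAt_tangent_snd_ne_zero hp hps), (extChartAt (modelT n) y).left_inv hp]
    refine ((extChartAt (modelCoT n) (legendre L y)).left_inv ?_).symm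
    exact mem_extChartAt_cotangent_source.2 (mem_extChartAt_tangent_source.1 hp)
  have ht : fiberLegendre (fun z => L ((extChartAt (modelT n) y).symm z))
      (extChartAt (modelT n) y y) ∈ (extChartAt (modelCoT n) (legendre L y)).target := by
    rw [← hL.extChartAt_legendre hyt
      (extChartAt_tangent_snd_ne_zero (mem_extChartAt_source y) hy), extChartAt_to_inv]
    exact mem_extChartAt_target _
  have h3 := (contMDiffOn_extChartAt_symm (I := modelCoT n) (n := ∞) (legendre L y)).contMDiffAt
    ((isOpen_extChartAt_target _).mem_nhds ht)
  refine ContMDiffAt.contMDiffWithinAt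
    (ContMDiffAt.congr_of_eventuallyEq (h3.comp y (h2.comp y h1)) ?_)
  filter_upwards [extChartAt_source_mem_nhds (I := modelT n) y,
    isOpen_slitTangent.mem_nhds hy] with p hp hps
  exact e p hp hps

theorem exists_continuousLinearEquiv_fderiv (hL : IsFinslerNorm L) {y : TangentBundle (𝓡 n) M}
    {z : EuclideanSpace ℝ (Fin n) × EuclideanSpace ℝ (Fin n)}
    (hz : z ∈ (extChartAt (modelT n) y).target) (hz2 : z.2 ≠ 0) :
    ∃ A : (EuclideanSpace ℝ (Fin n) × EuclideanSpace ℝ (Fin n)) ≃L[ℝ]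
        (EuclideanSpace ℝ (Fin n) × (EuclideanSpace ℝ (Fin n) →L[ℝ] ℝ)),
      HasFDerivAt (fiberLegendre fun z => L ((extChartAt (modelT n) y).symm z))
        (A : (EuclideanSpace ℝ (Fin n) × EuclideanSpace ℝ (Fin n)) →L[ℝ] _) z := by
  have hF := hL.contDiffAt_chart hz hz2
  have hinj := fderiv_fiberLegendre_injective hF
    (hL.isMinkowskiNorm_chart (mem_extChartAt_tangent_target.1 hz)) hz2
  have hdim : Module.finrank ℝ (EuclideanSpace ℝ (Fin n) × EuclideanSpace ℝ (Fin n)) =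
      Module.finrank ℝ (EuclideanSpace ℝ (Fin n) × (EuclideanSpace ℝ (Fin n) →L[ℝ] ℝ)) := by
    rw [Module.finrank_prod, Module.finrank_prod, ← (LinearMap.toContinuousLinearMap (𝕜 := ℝ)
      (E := EuclideanSpace ℝ (Fin n)) (F' := ℝ)).finrank_eq]
    exact congrArg _ Subspace.dual_finrank_eq.symm
  refine ⟨(LinearEquiv.ofInjectiveOfFinrankEq
    (fderiv ℝ (fiberLegendre fun z => L ((extChartAt (modelT n) y).symm z)) z).toLinearMap
    hinj hdim).toContinuousLinearEquiv, ?_⟩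
  exact ((contDiffAt_fiberLegendre hF).differentiableAt (by simp)).hasFDerivAt.congr_fderiv rfl

/-- The set-theoretic inverse agrees near each point with the local inverse from the inverse
function theorem, because `legendre L` is injective on the whole slit bundle. -/
theorem exists_contMDiffOn_inverse (hL : IsFinslerNorm L) :
    ∃ g : CotangentBundle n M → TangentBundle (𝓡 n) M,
      InvOn g (legendre L) (slitTangent n M) (slitCotangent n M) ∧
        ContMDiffOn (modelCoT n) (modelT n) ∞ g (slitCotangent n M) := by
  have hbij := hL.bijOn_legendre
  have hex : ∀ ξ : CotangentBundle n M, ∃ y : TangentBundle (𝓡 n) M,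
      ξ ∈ slitCotangent n M → y ∈ slitTangent n M ∧ legendre L y = ξ := by
    intro ξ
    by_cases hξ : ξ ∈ slitCotangent n M
    · obtain ⟨y, hy⟩ := hbij.surjOn hξ
      exact ⟨y, fun _ => hy⟩
    -- Any vector serves here: nothing is required of `g` on the zero section.
    · exact ⟨⟨ξ.proj, 0⟩, fun h => absurd h hξ⟩
  choose g hg using hex
  have hleft : LeftInvOn g (legendre L) (slitTangent n M) := fun y hy =>
    hbij.injOn (hg _ (hbij.mapsTo hy)).1 hy (hg _ (hbij.mapsTo hy)).2
  refine ⟨g, ⟨hleft, fun ξ hξ => (hg ξ hξ).2⟩, ?_⟩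
  intro ξ hξ
  obtain ⟨y, hy, rfl⟩ := hbij.surjOn hξ
  have hys := mem_extChartAt_source (I := modelT n) y
  have hyt := mem_extChartAt_target (I := modelT n) y
  have hy2 := extChartAt_tangent_snd_ne_zero hys hy
  obtain ⟨A, hA⟩ := hL.exists_continuousLinearEquiv_fderiv hyt hy2
  have hΦ := contDiffAt_fiberLegendre (hL.contDiffAt_chart hyt hy2)
  have hval : fiberLegendre (fun z => L ((extChartAt (modelT n) y).symm z))
      (extChartAt (modelT n) y y) = extChartAt (modelCoT n) (legendre L y) (legendre L y) := by
    rw [← hL.extChartAt_legendre hyt hy2, extChartAt_to_inv]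
  set h := hΦ.localInverse hA (by simp) with hdef
  have hh : ContDiffAt ℝ ∞ h (extChartAt (modelCoT n) (legendre L y) (legendre L y)) := by
    rw [← hval]; exact hΦ.to_localInverse hA (by simp)
  have hhy : h (extChartAt (modelCoT n) (legendre L y) (legendre L y)) =
      extChartAt (modelT n) y y := by
    rw [← hval]; exact hΦ.localInverse_apply_image hA (by simp)
  have hright : ∀ᶠ w in 𝓝 (extChartAt (modelCoT n) (legendre L y) (legendre L y)),
      fiberLegendre (fun z => L ((extChartAt (modelT n) y).symm z)) (h w) = w := by
    rw [← hval]
    exact (hΦ.hasStrictFDerivAt' hA (by simp)).eventually_right_inverse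
  -- By continuity the local inverse stays in the chart and off the zero section, where the chart
  -- expression of `legendre L` is valid.
  have htarget : ∀ᶠ w in 𝓝 (extChartAt (modelCoT n) (legendre L y) (legendre L y)),
      h w ∈ (extChartAt (modelT n) y).target ∧ (h w).2 ≠ 0 := by
    refine hh.continuousAt.preimage_mem_nhds (t := {z | z ∈ (extChartAt (modelT n) y).target ∧
      z.2 ≠ 0}) ?_
    rw [hhy]
    exact Filter.inter_mem ((isOpen_extChartAt_target y).mem_nhds hyt)
      ((isOpen_ne.preimage continuous_snd).mem_nhds hy2)
  have h1 := contMDiffAt_extChartAt (I := modelCoT n) (n := ∞) (x := legendre L y)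
  have h3 : ContMDiffAt 𝓘(ℝ, EuclideanSpace ℝ (Fin n) × EuclideanSpace ℝ (Fin n)) (modelT n) ∞
      (extChartAt (modelT n) y).symm
      (h (extChartAt (modelCoT n) (legendre L y) (legendre L y))) := by
    rw [hhy]
    exact (contMDiffOn_extChartAt_symm y).contMDiffAt ((isOpen_extChartAt_target _).mem_nhds hyt)
  refine ContMDiffAt.contMDiffWithinAt
    (ContMDiffAt.congr_of_eventuallyEq (h3.comp (legendre L y) (hh.contMDiffAt.comp _ h1)) ?_)
  filter_upwards [extChartAt_source_mem_nhds (I := modelCoT n) (legendre L y),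
    isOpen_slitCotangent.mem_nhds hξ, h1.continuousAt.eventually hright,
    h1.continuousAt.eventually htarget] with ζ hζ hζs hζr hζt
  have hp := extChartAt_tangent_symm_mem_slitTangent hζt.1 hζt.2
  refine hbij.injOn (hg ζ hζs).1 hp ?_
  rw [(hg ζ hζs).2]
  refine (extChartAt (modelCoT n) (legendre L y)).injOn hζ ?_ ?_
  · exact mem_extChartAt_cotangent_source.2
      (mem_extChartAt_tangent_source.1 ((extChartAt (modelT n) y).map_target hζt.1))
  · exact hζr.symm.trans (hL.extChartAt_legendre hζt.1 hζt.2).symm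

theorem isDiffeoOn_legendre (hL : IsFinslerNorm L) :
    IsDiffeoOn (modelT n) (modelCoT n) (legendre L) (slitTangent n M) (slitCotangent n M) where
  isOpen_source := isOpen_slitTangent
  isOpen_target := isOpen_slitCotangent
  bijOn := hL.bijOn_legendre
  smooth := hL.contMDiffOn_legendre
  smooth_inverse := hL.exists_contMDiffOn_inverse

end IsFinslerNorm

end Legendre

/-! ### The Hilbert form and the pullback of the Liouville form -/

section HilbertForm

variable {n : ℕ} {M : Type*} [TopologicalSpace M] [ChartedSpace (EuclideanSpace ℝ (Fin n)) M]
  [IsManifold (𝓡 n) ∞ M] {L : TangentBundle (𝓡 n) M → ℝ}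
  {e : OpenPartialHomeomorph M (EuclideanSpace ℝ (Fin n))}

omit [IsManifold (𝓡 n) ∞ M] in
theorem mdifferentiable_of_mem_maximalAtlas (he : e ∈ IsManifold.maximalAtlas (𝓡 n) ∞ M) :
    e.MDifferentiable (𝓡 n) (𝓡 n) :=
  ⟨(contMDiffOn_of_mem_maximalAtlas he).mdifferentiableOn (by simp),
    (contMDiffOn_symm_of_mem_maximalAtlas he).mdifferentiableOn (by simp)⟩

omit [IsManifold (𝓡 n) ∞ M] in
theorem sum_smul_coordVector (he : e ∈ IsManifold.maximalAtlas (𝓡 n) ∞ M) {x : M}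
    (hx : x ∈ e.source) (v : TangentSpace (𝓡 n) x) :
    ∑ i, (NormedSpace.fromTangentSpace (𝕜 := ℝ) (e x) (mfderiv (𝓡 n) (𝓡 n) e x v)) i •
      coordVector e x i = v := by
  have hinv : (mfderiv (𝓡 n) (𝓡 n) e x).inverse =
      (((mdifferentiable_of_mem_maximalAtlas he).mfderiv hx).symm :
        TangentSpace (𝓡 n) (e x) →L[ℝ] TangentSpace (𝓡 n) x) :=
    ContinuousLinearMap.inverse_equiv ((mdifferentiable_of_mem_maximalAtlas he).mfderiv hx)
  simp only [coordVector, hinv, ← map_smul, ← map_sum]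
  have hsum : ∀ w : EuclideanSpace ℝ (Fin n), ∑ i, w i • EuclideanSpace.single i (1 : ℝ) = w := by
    intro w
    simpa using (EuclideanSpace.basisFun (Fin n) ℝ).sum_repr w
  rw [hsum, ContinuousLinearEquiv.symm_apply_apply]
  exact ((mdifferentiable_of_mem_maximalAtlas he).mfderiv hx).symm_apply_apply v

theorem mdifferentiableAt_tangent_proj (y : TangentBundle (𝓡 n) M) :
    MDifferentiableAt (modelT n) (𝓡 n) (fun z : TangentBundle (𝓡 n) M => z.proj) y :=
  (contMDiff_proj (n := ∞) (TangentSpace (𝓡 n))).contMDiffAt.mdifferentiableAt (by simp)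

theorem mdifferentiableAt_cotangent_proj (ξ : CotangentBundle n M) :
    MDifferentiableAt (modelCoT n) (𝓡 n) (fun ζ : CotangentBundle n M => ζ.proj) ξ :=
  (contMDiff_proj (n := ∞) _).contMDiffAt.mdifferentiableAt (by simp)

theorem baseCoordDiff_apply (he : e ∈ IsManifold.maximalAtlas (𝓡 n) ∞ M)
    {y : TangentBundle (𝓡 n) M} (hy : y.proj ∈ e.source) (j : Fin n)
    (w : TangentSpace (modelT n) y) :
    baseCoordDiff e y j w = (NormedSpace.fromTangentSpace (𝕜 := ℝ) (e y.proj)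
      (mfderiv (𝓡 n) (𝓡 n) e y.proj
        (mfderiv (modelT n) (𝓡 n) (fun z : TangentBundle (𝓡 n) M => z.proj) y w))) j := by
  have h1 := (mdifferentiable_of_mem_maximalAtlas he).mdifferentiableAt hy
  have h2 := mdifferentiableAt_tangent_proj y
  have h3 : HasMFDerivAt 𝓘(ℝ, EuclideanSpace ℝ (Fin n)) 𝓘(ℝ, ℝ)
      (EuclideanSpace.proj j : EuclideanSpace ℝ (Fin n) →L[ℝ] ℝ) (e y.proj) _ :=
    (EuclideanSpace.proj j : EuclideanSpace ℝ (Fin n) →L[ℝ] ℝ).hasMFDerivAt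
  have h4 := h3.comp y (h1.hasMFDerivAt.comp y h2.hasMFDerivAt)
  have h5 : mfderiv (modelT n) 𝓘(ℝ, ℝ) (fun z : TangentBundle (𝓡 n) M => e z.proj j) y = _ :=
    h4.mfderiv
  rw [baseCoordDiff, h5]
  rfl

/-- The `1`-form `w ↦ g_y(y, dπ w)` on the tangent bundle. -/
def metricForm (L : TangentBundle (𝓡 n) M → ℝ) : Form (modelT n) (TangentBundle (𝓡 n) M) 1 :=
  oneForm fun y => (metricTensor L y y.snd).comp
    (mfderiv (modelT n) (𝓡 n) (fun z : TangentBundle (𝓡 n) M => z.proj) y)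

/-- Bilinearity of `g_y`, after expanding `y` and `dπ w` in the coordinate vectors of `e`. No chart
occurs on the right, which gives the independence of the chart. -/
theorem hilbertFormIn_eq (he : e ∈ IsManifold.maximalAtlas (𝓡 n) ∞ M)
    {y : TangentBundle (𝓡 n) M} (hy : y.proj ∈ e.source) :
    hilbertFormIn L e y = -metricForm L y := by
  ext w
  set p := mfderiv (modelT n) (𝓡 n) (fun z : TangentBundle (𝓡 n) M => z.proj) y (w 0) with hp
  change (-∑ i, ∑ j, (metricCoeff L e y i j * fiberCoord e y i) • baseCoordDiff e y j) (w 0) =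
    -(metricTensor L y y.snd p)
  have h1 : metricTensor L y y.snd p = metricTensor L y
      (∑ i, fiberCoord e y i • coordVector e y.proj i)
      (∑ j, baseCoordDiff e y j (w 0) • coordVector e y.proj j) := by
    congr 1
    · congr 1
      exact (sum_smul_coordVector he hy y.snd).symm
    · simp only [baseCoordDiff_apply he hy]
      exact (sum_smul_coordVector he hy p).symm
  rw [h1]
  simp only [map_sum, map_smul, neg_apply, sum_apply,
    smul_apply, smul_eq_mul, metricCoeff, Finset.mul_sum]
  rw [Finset.sum_comm]
  congr 1
  refine Finset.sum_congr rfl fun i _ => Finset.sum_congr rfl fun j _ => ?_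
  ring

theorem hilbertForm_eq (y : TangentBundle (𝓡 n) M) : hilbertForm L y = -metricForm L y :=
  hilbertFormIn_eq (IsManifold.chart_mem_maximalAtlas y.proj) (mem_chart_source _ y.proj)

/-- Differentiating `π ∘ 𝓛 = π` gives `𝓛(y) ∘ dπ ∘ d𝓛 = g_y(y, dπ ·)`. -/
theorem pullback_legendre_liouvilleForm (hL : IsFinslerNorm L) {y : TangentBundle (𝓡 n) M}
    (hy : y ∈ slitTangent n M) :
    pullback (legendre L) (liouvilleForm n M) y = -hilbertForm L y := by
  rw [hilbertForm_eq, neg_neg]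
  have h1 : MDifferentiableAt (modelT n) (modelCoT n) (legendre L) y :=
    (hL.contMDiffOn_legendre.contMDiffAt (isOpen_slitTangent.mem_nhds hy)).mdifferentiableAt
      (by simp)
  have h2 := mfderiv_comp y (mdifferentiableAt_cotangent_proj (legendre L y)) h1
  ext w
  exact congrArg (metricTensor L y y.snd) (DFunLike.congr_fun h2 (w 0)).symm

end HilbertForm

/-! ### The canonical symplectic form in bundle charts -/

section CanonicalForm

variable {n : ℕ} {M : Type*} [TopologicalSpace M] [ChartedSpace (EuclideanSpace ℝ (Fin n)) M]
  [IsManifold (𝓡 n) ∞ M]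

/-- The tautological `1`-form `∑ ξ_i dx^i` on the product of a vector space and its dual. -/
def tautologicalForm (V : Type*) [NormedAddCommGroup V] [NormedSpace ℝ V] :
    V × (V →L[ℝ] ℝ) →L[ℝ] (V × (V →L[ℝ] ℝ)) [⋀^Fin 1]→L[ℝ] ℝ :=
  ((ContinuousAlternatingMap.ofSubsingletonLIE (𝕜 := ℝ) (E := V × (V →L[ℝ] ℝ)) (F := ℝ)
    (0 : Fin 1)).toContinuousLinearEquiv : _ →L[ℝ] _).comp
    (((ContinuousLinearMap.compL ℝ (V × (V →L[ℝ] ℝ)) V ℝ).flip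
      (ContinuousLinearMap.fst ℝ V (V →L[ℝ] ℝ))).comp (ContinuousLinearMap.snd ℝ V (V →L[ℝ] ℝ)))

theorem tautologicalForm_apply {V : Type*} [NormedAddCommGroup V] [NormedSpace ℝ V]
    (z : V × (V →L[ℝ] ℝ)) (w : Fin 1 → V × (V →L[ℝ] ℝ)) :
    tautologicalForm V z w = z.2 (w 0).1 := rfl

/-- The form depends linearly on `z`, so it is its own derivative, and `extDeriv` only
antisymmetrises it. -/
theorem extDeriv_tautologicalForm {V : Type*} [NormedAddCommGroup V] [NormedSpace ℝ V]
    (z a b : V × (V →L[ℝ] ℝ)) :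
    extDeriv (tautologicalForm V) z ![a, b] = a.2 b.1 - b.2 a.1 := by
  rw [extDeriv, ContinuousLinearMap.fderiv, ContinuousAlternatingMap.alternatizeUncurryFin_apply]
  simp [Fin.sum_univ_two, tautologicalForm_apply, Fin.removeNth, Fin.succAbove]
  ring

/-- The base component of the bundle chart is the base chart after `π`, and its fibre component
precomposes `ξ` with the inverse derivative of that base chart; the two derivatives cancel. -/
theorem inChart_liouvilleForm (ζ : CotangentBundle n M)
    {z : EuclideanSpace ℝ (Fin n) × (EuclideanSpace ℝ (Fin n) →L[ℝ] ℝ)}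
    (hz : z ∈ (extChartAt (modelCoT n) ζ).target) :
    inChart (liouvilleForm n M) ζ z = tautologicalForm (EuclideanSpace ℝ (Fin n)) z := by
  set ξ := (extChartAt (modelCoT n) ζ).symm z with hξ
  have hξs := (extChartAt (modelCoT n) ζ).map_target hz
  have hξs' := mem_extChartAt_cotangent_source.1 hξs
  have hzξ : z = extChartAt (modelCoT n) ζ ξ := ((extChartAt (modelCoT n) ζ).right_inv hz).symm
  have hz2 := (congrArg Prod.snd hzξ).trans
    (congrArg Prod.snd (extChartAt_cotangent_apply hξs'))
  have h1 := mdifferentiableAt_extChartAt_symm hz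
  have h2 := mdifferentiableAt_cotangent_proj ξ
  have h3 := mdifferentiableAt_extChartAt' (I := 𝓡 n) (p := ζ.proj) (q := ξ.proj) (by simpa using! hξs')
  have h4 : (fun z => extChartAt (𝓡 n) ζ.proj ((extChartAt (modelCoT n) ζ).symm z).proj) =ᶠ[𝓝 z]
      Prod.fst := by
    filter_upwards [(isOpen_extChartAt_target ζ).mem_nhds hz] with w hw
    have hw' := mem_extChartAt_cotangent_source.1 ((extChartAt (modelCoT n) ζ).map_target hw)
    have := (extChartAt (modelCoT n) ζ).right_inv hw
    rw [extChartAt_cotangent_apply hw'] at this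
    exact congrArg Prod.fst this
  have h5 := h3.hasMFDerivAt.comp z (h2.hasMFDerivAt.comp z h1.hasMFDerivAt)
  have h6 := (h5.congr_of_eventuallyEq h4.symm)
  have h7 := hasMFDerivAt_unique h6 (hasFDerivAt_fst (𝕜 := ℝ) (p := z)).hasMFDerivAt
  ext w
  rw [tautologicalForm_apply, hz2]
  have h8 := DFunLike.congr_fun h7 (w 0)
  change _ = (w 0).1 at h8
  rw [← h8]
  change ξ.snd _ = (ξ.snd : EuclideanSpace ℝ (Fin n) →L[ℝ] ℝ) ((tangentCoord hξs').symm _)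
  congr 1
  exact ((tangentCoord hξs').symm_apply_apply _).symm.trans
    (congrArg (tangentCoord hξs').symm (tangentCoord_apply hξs' _))

theorem isSmoothOn_liouvilleForm (U : Set (CotangentBundle n M)) :
    IsSmoothOn (liouvilleForm n M) U := fun ζ =>
  (tautologicalForm (EuclideanSpace ℝ (Fin n))).contDiff.contDiffOn.congr
    fun _ hz => inChart_liouvilleForm ζ hz.1

theorem canonicalForm_apply (ξ : CotangentBundle n M) (v w : TangentSpace (modelCoT n) ξ) :
    canonicalForm n M ξ ![v, w] =
      (mfderiv (modelCoT n) 𝓘(ℝ, EuclideanSpace ℝ (Fin n) × (EuclideanSpace ℝ (Fin n) →L[ℝ] ℝ))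
        (extChartAt (modelCoT n) ξ) ξ w).2
        (mfderiv (modelCoT n) 𝓘(ℝ, EuclideanSpace ℝ (Fin n) × (EuclideanSpace ℝ (Fin n) →L[ℝ] ℝ))
        (extChartAt (modelCoT n) ξ) ξ v).1 -
      (mfderiv (modelCoT n) 𝓘(ℝ, EuclideanSpace ℝ (Fin n) × (EuclideanSpace ℝ (Fin n) →L[ℝ] ℝ))
        (extChartAt (modelCoT n) ξ) ξ v).2
        (mfderiv (modelCoT n) 𝓘(ℝ, EuclideanSpace ℝ (Fin n) × (EuclideanSpace ℝ (Fin n) →L[ℝ] ℝ))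
        (extChartAt (modelCoT n) ξ) ξ w).1 := by
  have h : inChart (liouvilleForm n M) ξ =ᶠ[𝓝 (extChartAt (modelCoT n) ξ ξ)]
      tautologicalForm (EuclideanSpace ℝ (Fin n)) := by
    filter_upwards [extChartAt_target_mem_nhds (I := modelCoT n) ξ] with z hz
    exact inChart_liouvilleForm ξ hz
  set D := mfderiv (modelCoT n)
    𝓘(ℝ, EuclideanSpace ℝ (Fin n) × (EuclideanSpace ℝ (Fin n) →L[ℝ] ℝ))
    (extChartAt (modelCoT n) ξ) ξ with hD
  have e : canonicalForm n M ξ ![v, w] =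
      -(extDeriv (inChart (liouvilleForm n M) ξ) (extChartAt (modelCoT n) ξ ξ) ![D v, D w]) := by
    refine congrArg Neg.neg (congrArg (extDeriv _ _) ?_)
    funext i
    fin_cases i <;> rfl
  rw [e, h.extDeriv_eq]
  exact (congrArg Neg.neg (extDeriv_tautologicalForm _ (D v) (D w))).trans (neg_sub _ _)

/-- The chart derivative `D` is bijective. Testing against horizontal vectors kills the fibre part
of `D v`, testing against vertical ones its base part. -/
theorem canonicalForm_nondegenerate (ξ : CotangentBundle n M) (v : TangentSpace (modelCoT n) ξ)
    (hv : ∀ w : TangentSpace (modelCoT n) ξ, canonicalForm n M ξ ![v, w] = 0) : v = 0 := by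
  set D := mfderiv (modelCoT n)
    𝓘(ℝ, EuclideanSpace ℝ (Fin n) × (EuclideanSpace ℝ (Fin n) →L[ℝ] ℝ))
    (extChartAt (modelCoT n) ξ) ξ with hD
  have hsurj : ∀ a : EuclideanSpace ℝ (Fin n) × (EuclideanSpace ℝ (Fin n) →L[ℝ] ℝ),
      ∃ w : TangentSpace (modelCoT n) ξ, D w = a := fun a => by
    have := mfderiv_extChartAt_comp_mfderiv_symm (mem_extChartAt_target (I := modelCoT n) ξ) a
    rw [extChartAt_to_inv] at this
    exact ⟨_, this⟩
  have hinj := mfderiv_symm_comp_mfderiv_extChartAt (mem_extChartAt_source (I := modelCoT n) ξ)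
  have key : ∀ a : EuclideanSpace ℝ (Fin n) × (EuclideanSpace ℝ (Fin n) →L[ℝ] ℝ),
      a.2 (D v).1 - (D v).2 a.1 = 0 := fun a => by
    obtain ⟨w, rfl⟩ := hsurj a
    exact (canonicalForm_apply ξ v w).symm.trans (hv w)
  have hDv : D v = 0 := by
    have h2 : (D v).2 = 0 := by
      ext a
      simpa using key (a, 0)
    have h1 : (D v).1 = 0 := by
      by_contra hne
      -- The covector dual to `(D v).1` takes the value `‖(D v).1‖²` on it.
      have := key (0, innerSL ℝ (D v).1)
      simp at this
      exact hne this
    exact Prod.ext h1 h2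
  exact (hinj v).symm.trans ((congrArg _ hDv).trans (ContinuousLinearMap.map_zero _))

theorem isSymplecticOn_canonicalForm :
    IsSymplecticOn (canonicalForm n M) (slitCotangent n M) where
  isOpen := isOpen_slitCotangent
  smooth := ((isSmoothOn_liouvilleForm _).extDer isOpen_slitCotangent).neg
  closed ξ hξ := by
    rw [canonicalForm, extDer_neg]
    change -extDer (extDer (liouvilleForm n M)) ξ = 0
    rw [extDer_extDer isOpen_slitCotangent (isSmoothOn_liouvilleForm _) hξ, neg_zero]
  nondegenerate ξ _ v hv := canonicalForm_nondegenerate ξ v hv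

end CanonicalForm

/-! ### Transport of the symplectic structure -/

section Main

variable {n : ℕ} {M : Type*} [TopologicalSpace M] [ChartedSpace (EuclideanSpace ℝ (Fin n)) M]
  [IsManifold (𝓡 n) ∞ M] {L : TangentBundle (𝓡 n) M → ℝ}

theorem IsDiffeoOn.exists_mfderiv_inverse {E E' H H' X Y : Type*} [NormedAddCommGroup E]
    [NormedSpace ℝ E] [NormedAddCommGroup E'] [NormedSpace ℝ E'] [TopologicalSpace H]
    [TopologicalSpace H'] {I : ModelWithCorners ℝ E H} {J : ModelWithCorners ℝ E' H'}
    [TopologicalSpace X] [ChartedSpace H X] [TopologicalSpace Y] [ChartedSpace H' Y]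
    {f : X → Y} {U : Set X} {V : Set Y} (h : IsDiffeoOn I J f U V) {p : X} (hp : p ∈ U) :
    ∃ B : TangentSpace J (f p) →L[ℝ] TangentSpace I p,
      (∀ v, B (mfderiv I J f p v) = v) ∧ ∀ w, mfderiv I J f p (B w) = w := by
  obtain ⟨g, hg, hgs⟩ := h.smooth_inverse
  have hfp := h.bijOn.mapsTo hp
  have hf : MDifferentiableAt I J f p :=
    (h.smooth.contMDiffAt (h.isOpen_source.mem_nhds hp)).mdifferentiableAt (by simp)
  have hg' : MDifferentiableAt J I g (f p) :=
    (hgs.contMDiffAt (h.isOpen_target.mem_nhds hfp)).mdifferentiableAt (by simp)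
  have hgp : g (f p) = p := hg.1 hp
  have h1 : HasMFDerivAt I I (g ∘ f) p (ContinuousLinearMap.id ℝ (TangentSpace I p)) := by
    refine (hasMFDerivAt_id p).congr_of_eventuallyEq ?_
    filter_upwards [h.isOpen_source.mem_nhds hp] with q hq
    exact hg.1 hq
  have h2 : HasMFDerivAt J J (f ∘ g) (f p) (ContinuousLinearMap.id ℝ (TangentSpace J (f p))) := by
    refine (hasMFDerivAt_id (f p)).congr_of_eventuallyEq ?_
    filter_upwards [h.isOpen_target.mem_nhds hfp] with q hq
    exact hg.2 hq
  have hfd : HasMFDerivAt I J f (g (f p)) (mfderiv I J f p) := by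
    rw [hgp]; exact hf.hasMFDerivAt
  exact ⟨mfderiv J I g (f p),
    fun v => DFunLike.congr_fun
      (hasMFDerivAt_unique (hg'.hasMFDerivAt.comp p hf.hasMFDerivAt) h1) v,
    fun w => DFunLike.congr_fun (hasMFDerivAt_unique (hfd.comp (f p) hg'.hasMFDerivAt) h2) w⟩

namespace IsFinslerNorm

/-- Smoothness comes from `η = -𝓛^* α`, avoiding the coefficients `g_ij`. -/
theorem isSmoothOn_hilbertForm (hL : IsFinslerNorm L) :
    IsSmoothOn (hilbertForm L) (slitTangent n M) := by
  refine ((isSmoothOn_liouvilleForm (slitCotangent n M)).pullback isOpen_slitTangent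
    isOpen_slitCotangent hL.contMDiffOn_legendre hL.legendre_mem_slitCotangent).neg.congr ?_
  intro y hy
  change _ = -pullback (legendre L) (liouvilleForm n M) y
  rw [pullback_legendre_liouvilleForm hL hy, neg_neg]

/-- Naturality of `d`; the signs in `ω = -dα` and `𝓛^* α = -η` cancel. -/
theorem pullback_legendre_canonicalForm (hL : IsFinslerNorm L) {y : TangentBundle (𝓡 n) M}
    (hy : y ∈ slitTangent n M) :
    pullback (legendre L) (canonicalForm n M) y = extDer (hilbertForm L) y := by
  have h1 := extDer_pullback isOpen_slitTangent isOpen_slitCotangent hL.contMDiffOn_legendre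
    hL.legendre_mem_slitCotangent (isSmoothOn_liouvilleForm (slitCotangent n M)) hy
  have h2 : extDer (pullback (I := modelT n) (legendre L) (liouvilleForm n M)) y =
      extDer (-hilbertForm L) y :=
    extDer_congr isOpen_slitTangent (fun p hp => pullback_legendre_liouvilleForm hL hp) hy
  have h3 : pullback (I := modelT n) (legendre L) (canonicalForm n M) y =
      -pullback (I := modelT n) (legendre L) (extDer (liouvilleForm n M)) y := rfl
  rw [h3, ← h1, h2, extDer_neg]
  exact neg_neg _

theorem isSymplecticOn_extDer_hilbertForm (hL : IsFinslerNorm L) :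
    IsSymplecticOn (extDer (hilbertForm L)) (slitTangent n M) where
  isOpen := isOpen_slitTangent
  smooth := hL.isSmoothOn_hilbertForm.extDer isOpen_slitTangent
  closed _ hy := extDer_extDer isOpen_slitTangent hL.isSmoothOn_hilbertForm hy
  nondegenerate y hy v hv := by
    obtain ⟨B, hB1, hB2⟩ := hL.isDiffeoOn_legendre.exists_mfderiv_inverse hy
    -- Every vector at `𝓛(y)` is some `d𝓛 (B w)`, so `d𝓛 v` lies in the kernel of `ω`.
    have h0 : mfderiv (modelT n) (modelCoT n) (legendre L) y v = 0 := by
      refine canonicalForm_nondegenerate (legendre L y) _ fun w => ?_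
      rw [← hB2 w, ← hv (B w), ← hL.pullback_legendre_canonicalForm hy]
      refine congrArg (canonicalForm n M (legendre L y)) (funext fun i => ?_)
      fin_cases i <;> rfl
    exact (hB1 v).symm.trans ((congrArg B h0).trans B.map_zero)

end IsFinslerNorm

end Main

end Finsler

end

theorem mainTheorem10 {n : ℕ} {M : Type*} [TopologicalSpace M]
    [ChartedSpace (EuclideanSpace ℝ (Fin n)) M] [IsManifold (𝓡 n) ∞ M]
    (L : TangentBundle (𝓡 n) M → ℝ) (hL : Finsler.IsFinslerNorm L) :
    -- the Hilbert form is globally defined (its local expressions do not depend on the chart)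
    -- and smooth
    (∀ e ∈ IsManifold.maximalAtlas (𝓡 n) ∞ M, ∀ y ∈ Finsler.slitTangent n M,
      y.proj ∈ e.source → Finsler.hilbertFormIn L e y = Finsler.hilbertForm L y) ∧
    Finsler.IsSmoothOn (Finsler.hilbertForm L) (Finsler.slitTangent n M) ∧
    -- `𝓛^* α = -η`
    (∀ y ∈ Finsler.slitTangent n M,
      Finsler.pullback (Finsler.legendre L) (Finsler.liouvilleForm n M) y
        = -Finsler.hilbertForm L y) ∧
    -- `dη` is a symplectic form on `TM ∖ 0`
    Finsler.IsSymplecticOn (Finsler.extDer (Finsler.hilbertForm L)) (Finsler.slitTangent n M) ∧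
    -- `𝓛 : (TM ∖ 0, dη) → (T*M ∖ 0, -dα)` is a symplectomorphism
    Finsler.IsSymplectomorphismOn (Finsler.legendre L)
      (Finsler.extDer (Finsler.hilbertForm L)) (Finsler.slitTangent n M)
      (Finsler.canonicalForm n M) (Finsler.slitCotangent n M) := by
  refine ⟨fun e he y _ hy => ?_, hL.isSmoothOn_hilbertForm,
    fun y hy => Finsler.pullback_legendre_liouvilleForm hL hy,
    hL.isSymplecticOn_extDer_hilbertForm,
    ⟨hL.isSymplecticOn_extDer_hilbertForm, Finsler.isSymplecticOn_canonicalForm,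
      hL.isDiffeoOn_legendre, fun y hy => hL.pullback_legendre_canonicalForm hy⟩⟩
  rw [Finsler.hilbertFormIn_eq he hy, Finsler.hilbertForm_eq]
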